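/- **Setting.** Let $n,k,r\ge 1$ be integers with $r\mid n$, $r\mid k$, $n>2r$ and $k\le d:=n-r$. A file of $M$ bits is stored on $n$ nodes, each holding at most $\alpha$ bits. In a repair round any $r$ nodes fail; each of the $d=n-r$ surviving nodes broadcasts the same number $\beta$ of bits, computed from its own content, and every failed node computes a new content from the broadcast messages alone; $\gamma=d\beta$ is the repair bandwidth. The pair $(\alpha,\gamma)$ is *achievable with functional repair* if there is such a code for which, after any number of rounds with arbitrary failures, the contents of any $k$ nodes determine the file. It is *on the tradeoff curve* if it is achievable and no achievable pair for the same $M$ improves one coordinate without worsening the other. Put $B=\tfrac{k\,(2(n-2r)-(k-r))}{2}+r(k-r)$. **Construction.** Let $L\supseteq K$ be finite fields, $|K|=q$. The file is cut into $B$ packets $m_1,\dots,m_B\in L$, and $f(x)=\sum_{i=1}^{B}m_i x^{q^{i-1}}$. Each node stores $n-2r$ points $(x,f(x))$, whose $x$ are linearly independent over $K$; the subspace stored by a set of nodes is the $K$-span of their $x$'s. In a round, every node encodes its points with an $(n-1,n-2r)$ MDS code over $K$, whose coded symbols are indexed by the other nodes, and each helper broadcasts its symbols indexed by the $r$ failed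 nodes. The broadcast points are arranged in an $(n-2r)\times 2r$ matrix $$Y=\left[\;S\;\middle|\;\begin{matrix}\phi\\ \vdots\\ \phi\end{matrix}\;\right],$$ where $S$ is the $(n-2r)\times r$ array of the points of $n-2r$ helpers (one helper per row, one failed node per column) with its columns shifted cyclically, column $b$ by $b$ places, and $\phi$ is the $r\times r$ array of the points of the other $r$ helpers, shifted in the same way; so no row contains two points of the same helper. The $b$-th block of $r$ consecutive rows of $Y$ is multiplied by a $2r\times r$ matrix $M_b$ over $K$ such that $[\,I\ \ M_b\,]$ generates a $(3r,2r)$ MDS code, and the $j$-th column of the resulting $(n-2r)\times r$ matrix is stored at the $j$-th failed node. Initially $n-r$ nodes hold jointly linearly independent points, and the remaining $r$ nodes are filled by a repair round. **Theorem.** There is $q_0=q_0(n,k,r)$ such that the following holds whenever $q=|K|\ge q_0$ and $[L:K]\ge (n-r)(n-2r)$. 1. The MDS codes and the matrices $M_b$ of every round can be chosen, as a function of the points currently stored (before the failures of the round are known; with all $M_b$ equal if $r=1$), such that for every initial filling, for all failures and for all assignments of the roles in $Y$, after every round: the points of each node are linearly independent, any $k$ nodes span a subspace of dimension at least $$\frac{k\,\bigl(2(n-2r)-(k-r)\bigr)}{2}+r(k-r),$$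 and the points of any $k$ nodes determine the file. 2. For $M=B\log_2|L|$ the pair $$(\alpha,\gamma)=\frac{2M}{k\bigl(2(n-2r)-(k-r)\bigr)+2r(k-r)}\,\bigl(n-2r,\ r(n-r)\bigr)$$ is achievable with functional repair. If $k\ge 2r$, it lies on the tradeoff curve. If $k\ge 3r$, it is neither of its end points: $\alpha>M/k$ (the minimum storage) and $\gamma>\frac{2M}{k(2d-k+r)}\,rd$ (the minimum bandwidth). -/

import Mathlib

/-! ### Functional repair of `r` nodes by broadcast, and the storage / bandwidth tradeoff -/

/-- A functional repair code for `n` nodes, with files in `F`, node contents in `A` and helper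
messages in `Q`. A configuration `E : Fin n → F → A` says what every node holds as a function of
the file, and `𝒢` is the set of configurations in which the system may be.
* Reconstruction: in every configuration the contents of any `k` nodes determine the file.
* Repair: whenever `r` nodes `R` fail and `d` surviving nodes `H` help, each helper can broadcast
  one message computed from its own content, and each failed node can compute a new content from
  the `d` messages alone, so that the new configuration is again in `𝒢` (hence any number of
  repair rounds, with arbitrary failures, is possible). -/
def IsFunctionalRepairCode (n k d r : ℕ) {F A : Type} (Q : Type)
    (𝒢 : Set (Fin n → F → A)) : Prop :=
  𝒢.Nonempty ∧ ∀ E ∈ 𝒢,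
    (∀ S : Finset (Fin n), S.card = k →
      Function.Injective (fun (f : F) (i : S) => E i f)) ∧
    ∀ R H : Finset (Fin n), R.card = r → H.card = d → Disjoint R H →
      ∃ (μ : H → A → Q) (ρ : Fin n → (H → Q) → A),
        (fun (i : Fin n) (f : F) => if i ∈ R then ρ i (fun h => μ h (E h f)) else E i f) ∈ 𝒢

/-- `(α, γ)` is achievable with functional repair for a file of `M` bits: there is a functional
repair code with `2 ^ M` files, at most `α` bits stored per node, and at most `γ` bits broadcast
in total by the `d` helpers in a repair round. -/
def Achievable (n k d r : ℕ) (M α γ : ℝ) : Prop :=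
  ∃ (N a b : ℕ) (𝒢 : Set (Fin n → Fin N → Fin a)),
    0 < N ∧ Real.logb 2 N = M ∧ Real.logb 2 a ≤ α ∧ (d : ℝ) * Real.logb 2 b ≤ γ ∧
    IsFunctionalRepairCode n k d r (Fin b) 𝒢

/-- `(α, γ)` lies on the optimal storage / repair-bandwidth tradeoff curve: it is achievable, and
no achievable pair improves one coordinate without worsening the other. -/
def OnTradeoffCurve (n k d r : ℕ) (M α γ : ℝ) : Prop :=
  Achievable n k d r M α γ ∧
    ∀ α' γ' : ℝ, Achievable n k d r M α' γ' → α' ≤ α → γ' ≤ γ → α' = α ∧ γ' = γ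

/-! ### The code construction -/

/-- `G` (with `κ` as rows and `ι` as columns) generates an MDS code of length `|ι|` and dimension
`|κ|`: any `|κ|` distinct columns are linearly independent. -/
def IsMDS {K κ ι : Type*} [Field K] (G : Matrix κ ι K) : Prop :=
  ∀ s : κ → ι, Function.Injective s → LinearIndependent K (fun c => G.col (s c))

/-- The value at `x` of the linearized polynomial `∑ aᵢ x ^ (q ^ i)`, `i = 0, …, P - 1`, whose
coefficients are the packets of the file. -/
def linearizedEval {L : Type*} [Field L] (q : ℕ) {P : ℕ} (a : Fin P → L) (x : L) : L :=
  ∑ i : Fin P, a i * x ^ q ^ (i : ℕ)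

/-- The points stored at the nodes. Node `i` stores the `n - 2r` points `(X i s, f (X i s))` of
the linearized polynomial `f`. Every operation of the scheme is linear over the small field, hence
acts in the same way on both coordinates, and it is enough to record the first one. -/
abbrev PointState (n r : ℕ) (L : Type*) : Type _ := Fin n → Fin (n - 2 * r) → L

/-- The short MDS codes used in one round.
`enc i` is the `(n - 1, n - 2r)` code of node `i`, whose coded symbols are indexed by the other
nodes. (Systematic form is a change of basis of the points stored at node `i`, which does not
change the stored subspace.)
`mix b` is the `2r × r` mixing matrix `M` of the `b`-th block of `r` consecutive rows, such that
`[I M]` generates a `(3r, 2r)` MDS code; only the blocks `b < (n - 2r) / r` occur. -/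
structure RoundCodes (n r : ℕ) (K : Type*) [Field K] where
  enc : (i : Fin n) → Matrix (Fin (n - 2 * r)) {j : Fin n // j ≠ i} K
  enc_mds : ∀ i, IsMDS (enc i)
  mix : ℕ → Matrix (Fin r ⊕ Fin r) (Fin r) K
  mix_mds : ∀ b, IsMDS (Matrix.fromCols (1 : Matrix (Fin r ⊕ Fin r) (Fin r ⊕ Fin r) K) (mix b))

/-- The roles of the nodes in a round: `n - 2r` first helpers, `r` last helpers, `r` newcomers,
each group in some order. -/
abbrev Roles (n r : ℕ) : Type := (Fin (n - 2 * r) ⊕ Fin r) ⊕ Fin r ≃ Fin n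

section Scheme

variable {n r : ℕ} {K L : Type*} [Field K] [Field L] [Algebra K L]

/-- The coded symbol `w_{hj}` sent by the helper `h` for the newcomer `j`. -/
def codedSymbol (C : RoundCodes n r K) (X : PointState n r L) (e : Roles n r)
    (h : Fin (n - 2 * r) ⊕ Fin r) (j : Fin r) : L :=
  ∑ s, C.enc (e (Sum.inl h)) s
    ⟨e (Sum.inr j), fun hj => Sum.inr_ne_inl (e.injective hj)⟩ • X (e (Sum.inl h)) s

/-- The `(n - 2r) × 2r` matrix `Y` of the broadcast points. Its first `r` columns are the
`n - 2r` by `r` array of the points of the first helpers, with column `b` shifted cyclically by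
`b`; its last `r` columns are copies, one below the other, of the `r × r` array of the points of
the last helpers, shifted in the same way. So no row has two points of the same helper. -/
def receivedMatrix (C : RoundCodes n r K) (X : PointState n r L) (e : Roles n r) :
    Matrix (Fin (n - 2 * r)) (Fin r ⊕ Fin r) L
  | a, Sum.inl b =>
      codedSymbol C X e (Sum.inl ⟨(a + b : ℕ) % (n - 2 * r), Nat.mod_lt _ a.pos⟩) b
  | a, Sum.inr b => codedSymbol C X e (Sum.inr ⟨(a + b : ℕ) % r, Nat.mod_lt _ b.pos⟩) b

/-- One repair round: each block of `r` rows of `Y` is multiplied by its mixing matrix, and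
newcomer `j` stores the `j`-th column of the product. Surviving nodes are unchanged. -/
def repairRound (C : RoundCodes n r K) (X : PointState n r L) (e : Roles n r) :
    PointState n r L := fun i a =>
  match e.symm i with
  | Sum.inl _ => X i a
  | Sum.inr j => ∑ c, C.mix ((a : ℕ) / r) c j • receivedMatrix C X e a c

/-- The stored points after `t` rounds, with the roles `e 0, e 1, …`; the codes of each round are
chosen by the rule `σ` from the points currently stored, before the next failures are known. -/
def stateAfter (σ : PointState n r L → RoundCodes n r K) (X₀ : PointState n r L)
    (e : ℕ → Roles n r) : ℕ → PointState n r L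
  | 0 => X₀
  | t + 1 => repairRound (σ (stateAfter σ X₀ e t)) (stateAfter σ X₀ e t) (e t)

/-- The subspace stored by a set of nodes. -/
def storedSubspace (K : Type*) {L : Type*} [Field K] [Field L] [Algebra K L]
    (X : PointState n r L) (S : Finset (Fin n)) : Submodule K L :=
  ⨆ i ∈ S, Submodule.span K (Set.range (X i))

end Scheme

/-- The number of packets of a file, `k (2 (n - 2r) - (k - r)) / 2 + r (k - r)`. -/
def packetCount (n k r : ℕ) : ℕ := k * (2 * (n - 2 * r) - (k - r)) / 2 + r * (k - r)

/-!
With `ν = (n - 2r) / r`, let `f` be the function `cutValue ν r`, whose slope after `i r` nodes is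
`min (n - 2r) (n - r - i r)`, and piecewise linear in between. At `k` it is the number of packets.
The invariant of the construction is `IsSpread`: every set of `s` nodes stores a subspace of
dimension at least `f s`. It concerns the currently stored points only, so that the codes of a
round can be a function of them.

The invariant survives a round because of a generic position argument. Consider survivors `P` and
newcomers `Q`. If the symbols of each helper are generic in the subspace it stores, then
`exists_generic_messages` gives a set `T ⊇ P` of helpers whose stored subspace lies in the span
`W` of the points of `P` and `Q`, such that modulo this subspace the only relations among the
points of `Q` are those that hold identically in the symbols of the helpers outside `T`. Hence
`dim W ≥ f |T| + R`, where `R` is the number of combinations at `Q` independent in these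
symbols. The rows of the received matrix fall into `r` classes modulo `r`; in each class every
block of rows has its own `r` symbols of first helpers, and all share `r` symbols of last helpers.
For generic mixing matrices (`MixGeneric`) `R` is therefore given by a matching, and the cyclic
shifts distribute the symbols of the helpers outside `T` evenly over the classes. A convexity
argument (`cut_slope_sum_le`) then gives `R ≥ f (|T| + |Q|) - f |T|`, hence
`dim W ≥ f (|P| + |Q|)`.

All these conditions are expressed by nonvanishing polynomials whose degrees are bounded in terms of
`n` and `r` (`HoldsOffHypersurface`), so by the Schwartz–Zippel principle a large field `K` has
codes that satisfy them for all failures at once (`exists_round_rule`).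

A linearized polynomial with `P` coefficients is determined by its values on a subspace of dimension
`P`, so the spread states form a functional repair code. Conversely, if groups of `r` nodes fail
one after the other, each group adds at most `min (r α) ((d - i r) γ / d)` bits to what the
previous `i` groups know (`IsFunctionalRepairCode.card_le`). The code attains this bound with
`r α = (d - r) γ / d`, so neither coordinate can be lowered once the second group occurs.
-/

/-! ### Generic properties -/

/-- The property `Φ` of points of `K ^ ι` holds off a hypersurface of degree at most `D`: some
nonzero polynomial of total degree at most `D` vanishes wherever `Φ` fails. -/
def HoldsOffHypersurface {ι K : Type*} [CommSemiring K] (D : ℕ) (Φ : (ι → K) → Prop) : Prop :=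
  ∃ p : MvPolynomial ι K, p ≠ 0 ∧ p.totalDegree ≤ D ∧ ∀ x, MvPolynomial.eval x p ≠ 0 → Φ x

namespace HoldsOffHypersurface

variable {ι K : Type*} [Field K] {D : ℕ}

theorem of_forall {Φ : (ι → K) → Prop} (h : ∀ x, Φ x) : HoldsOffHypersurface D Φ :=
  ⟨1, one_ne_zero, by simp, fun x _ => h x⟩

theorem mono {D' : ℕ} {Φ Ψ : (ι → K) → Prop} (h : HoldsOffHypersurface D Φ) (hD : D ≤ D')
    (hΦ : ∀ x, Φ x → Ψ x) : HoldsOffHypersurface D' Ψ := by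
  obtain ⟨p, h0, hd, h⟩ := h
  exact ⟨p, h0, hd.trans hD, fun x hx => hΦ x (h x hx)⟩

theorem and {D' : ℕ} {Φ Ψ : (ι → K) → Prop} (h : HoldsOffHypersurface D Φ)
    (h' : HoldsOffHypersurface D' Ψ) : HoldsOffHypersurface (D + D') (fun x => Φ x ∧ Ψ x) := by
  obtain ⟨p, h0, hd, h⟩ := h
  obtain ⟨p', h0', hd', h'⟩ := h'
  refine ⟨p * p', mul_ne_zero h0 h0', (MvPolynomial.totalDegree_mul _ _).trans
    (add_le_add hd hd'), fun x hx => ?_⟩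
  rw [map_mul] at hx
  exact ⟨h x (left_ne_zero_of_mul hx), h' x (right_ne_zero_of_mul hx)⟩

theorem forall_fintype {J : Type*} [Fintype J] {Φ : J → (ι → K) → Prop}
    (h : ∀ j, HoldsOffHypersurface D (Φ j)) :
    HoldsOffHypersurface (Fintype.card J * D) (fun x => ∀ j, Φ j x) := by
  choose p h0 hd h using h
  refine ⟨∏ j, p j, Finset.prod_ne_zero_iff.2 fun j _ => h0 j,
    (MvPolynomial.totalDegree_finsetProd _ _).trans ?_, fun x hx j => ?_⟩
  · refine (Finset.sum_le_card_nsmul _ _ D fun j _ => hd j).trans ?_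
    simp
  · rw [map_prod] at hx
    exact h j x (Finset.prod_ne_zero_iff.1 hx j (Finset.mem_univ j))

/-- The Schwartz–Zippel principle: a finite field with more than `D` elements has a point off a
hypersurface of degree `D`. -/
theorem exists_point [Finite ι] [Fintype K] {Φ : (ι → K) → Prop}
    (h : HoldsOffHypersurface D Φ) (hD : D < Fintype.card K) : ∃ x, Φ x := by
  obtain ⟨p, h0, hd, h⟩ := h
  by_contra hx
  push Not at hx
  refine h0 (MvPolynomial.eq_zero_of_eval_zero_at_prod_finset p (fun _ => Finset.univ) (fun i => ?_)
    fun x _ => ?_)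
  · rw [Finset.card_univ]
    exact ((MvPolynomial.degreeOf_le_totalDegree p i).trans hd).trans_lt hD
  · by_contra hne
    exact hx x (h x hne)

/-- A family of vectors depending affinely on a point of `K ^ ι` that is linearly independent at
one point is so off a hypersurface: a suitable minor of it does not vanish identically. -/
theorem linearIndependent [Fintype ι] {κ V : Type*} [Fintype κ] [AddCommGroup V] [Module K V]
    (c : κ → V) (u : κ → ι → V) (x₀ : ι → K)
    (h : LinearIndependent K (fun i => c i + ∑ e, x₀ e • u i e)) :
    HoldsOffHypersurface (Fintype.card κ)
      (fun x : ι → K => LinearIndependent K (fun i => c i + ∑ e, x e • u i e)) := by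
  classical
  -- linear functionals dual to the independent vectors at `x₀`
  obtain ⟨ψ, hψ⟩ : ∃ ψ : V →ₗ[K] (κ → K),
      ∀ i, ψ (c i + ∑ e, x₀ e • u i e) = Pi.single i 1 := by
    obtain ⟨g, hg⟩ := LinearMap.exists_leftInverse_of_injective
      (Fintype.linearCombination K (fun i => c i + ∑ e, x₀ e • u i e))
      (LinearMap.ker_eq_bot.2 (linearIndependent_iff_injective_fintypeLinearCombination.1 h))
    refine ⟨g, fun i => ?_⟩
    have := LinearMap.congr_fun hg (Pi.single i 1)
    simpa [Fintype.linearCombination_apply_single] using this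
  let N : Matrix κ κ (MvPolynomial ι K) := Matrix.of fun i j =>
    MvPolynomial.C (ψ (c i) j) + ∑ e, MvPolynomial.C (ψ (u i e) j) * MvPolynomial.X e
  have hN : ∀ x : ι → K, (MvPolynomial.eval x) N.det =
      Matrix.det (Matrix.of fun i j => ψ (c i + ∑ e, x e • u i e) j) := by
    intro x
    rw [RingHom.map_det]
    congr 1
    ext i j
    simp [N, mul_comm, Finset.sum_apply]
  refine ⟨N.det, fun h0 => ?_, ?_, fun x hx => ?_⟩
  · have h1 := hN x₀
    rw [h0, map_zero] at h1
    have h2 : (Matrix.of fun i j => ψ (c i + ∑ e, x₀ e • u i e) j : Matrix κ κ K) = 1 := by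
      ext i j
      rw [Matrix.of_apply, hψ, Matrix.one_apply, Pi.single_apply]
      simp [eq_comm]
    rw [h2, Matrix.det_one] at h1
    exact zero_ne_one h1
  · rw [Matrix.det_apply]
    refine MvPolynomial.totalDegree_finsetSum_le fun s _ => ?_
    refine (MvPolynomial.totalDegree_smul_le _ _).trans ?_
    refine (MvPolynomial.totalDegree_finsetProd _ _).trans ?_
    refine (Finset.sum_le_card_nsmul _ _ 1 fun j _ => ?_).trans (by simp)
    refine (MvPolynomial.totalDegree_add _ _).trans (max_le (by simp) ?_)
    refine MvPolynomial.totalDegree_finsetSum_le fun e _ => ?_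
    refine (MvPolynomial.totalDegree_mul _ _).trans ?_
    simp [MvPolynomial.totalDegree_X]
  · rw [hN] at hx
    have h1 := Matrix.linearIndependent_rows_of_det_ne_zero hx
    exact LinearIndependent.of_comp ψ h1

/-- A lower bound for the dimension spanned by a family of vectors depending affinely on a point
of `K ^ ι` holds off a hypersurface as soon as it holds at one point. -/
theorem le_finrank_span [Fintype ι] {κ V : Type*} [Finite κ] [AddCommGroup V] [Module K V]
    (c : κ → V) (u : κ → ι → V) (x₀ : ι → K)
    (h : D ≤ Module.finrank K (Submodule.span K (Set.range fun i => c i + ∑ e, x₀ e • u i e))) :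
    HoldsOffHypersurface D (fun x : ι → K =>
      D ≤ Module.finrank K (Submodule.span K (Set.range fun i => c i + ∑ e, x e • u i e))) := by
  classical
  obtain ⟨s, a, ha, hs, hli⟩ := exists_linearIndependent' K (fun i => c i + ∑ e, x₀ e • u i e)
  have : Finite s := Finite.of_injective a ha
  have := Fintype.ofFinite s
  have hcard : D ≤ Fintype.card s := by
    rw [← hs, finrank_span_eq_card hli] at h
    exact h
  obtain ⟨t, -, ht⟩ := Finset.exists_subset_card_eq (s := (Finset.univ : Finset s))
    (n := D) (by simpa using hcard)
  have hli' := hli.comp (fun i : t => (i : s)) Subtype.val_injective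
  refine (linearIndependent (fun i : t => c (a i)) (fun i : t => u (a i)) x₀ hli').mono
    (by simp [ht]) fun x hx => ?_
  have h1 := finrank_span_eq_card hx
  have : FiniteDimensional K
      (Submodule.span K (Set.range fun i => c i + ∑ e, x e • u i e)) :=
    FiniteDimensional.span_of_finite K (Set.finite_range _)
  calc D = Fintype.card t := by simp [ht]
    _ = _ := h1.symm
    _ ≤ _ := Submodule.finrank_mono (Submodule.span_mono (by
      rintro _ ⟨i, rfl⟩; exact ⟨a i, rfl⟩))

end HoldsOffHypersurface

/-! ### The cut function -/

/-- The lower bound for the dimension stored by `s` nodes, for `m = ν r` points per node and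
`d = (ν + 1) r` helpers: it is piecewise linear in `s`, and its slope after `i r` nodes is
`min m (d - i r)`. -/
def cutValue (ν r s : ℕ) : ℕ := r * ∑ i ∈ Finset.range s, min ν (ν + 1 - i / r)

theorem cutValue_mono (ν r : ℕ) : Monotone (cutValue ν r) := fun _ _ h =>
  Nat.mul_le_mul_left _ (Finset.sum_le_sum_of_subset (Finset.range_mono h))

theorem cutValue_le (ν r s : ℕ) : cutValue ν r s ≤ s * (r * ν) := by
  have : ∑ i ∈ Finset.range s, min ν (ν + 1 - i / r) ≤ s * ν := by
    refine (Finset.sum_le_card_nsmul _ _ ν fun i _ => min_le_left _ _).trans ?_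
    simp
  calc cutValue ν r s ≤ r * (s * ν) := Nat.mul_le_mul_left _ this
    _ = _ := by ring

theorem cutValue_one (ν r : ℕ) : cutValue ν r 1 = r * ν := by
  simp [cutValue]

/-- At a multiple of `r`, the cut function is the capacity of the cut that isolates one group of
`r` nodes after the other. -/
theorem cutValue_mul {r : ℕ} (hr : 0 < r) (ν κ : ℕ) :
    cutValue ν r (κ * r) = ∑ i ∈ Finset.range κ, r * min (r * ν) ((ν + 1) * r - i * r) := by
  induction κ with
  | zero => simp [cutValue]
  | succ κ ih =>
    rw [Finset.sum_range_succ, ← ih, cutValue, cutValue, Nat.succ_mul, Finset.sum_range_add,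
      mul_add]
    congr 2
    rw [Finset.sum_congr rfl (g := fun _ => min ν (ν + 1 - κ)) fun i hi => ?_]
    · rw [Finset.sum_const, Finset.card_range, smul_eq_mul, ← Nat.sub_mul,
        mul_comm _ r, Nat.mul_min_mul_left]
    · rw [Finset.mem_range] at hi
      rw [add_comm (κ * r), Nat.add_mul_div_right _ _ hr, Nat.div_eq_of_lt hi, zero_add]

/-- The function `s ↦ q ⌊s / r⌋ + (s % r + q - r)⁺` is superadditive. -/
theorem div_add_excess_superadditive {r q : ℕ} (hr : 0 < r) (hq : q ≤ r) (s s' : ℕ) :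
    (q * (s / r) + (s % r + q - r)) + (q * (s' / r) + (s' % r + q - r)) ≤
      q * ((s + s') / r) + ((s + s') % r + q - r) := by
  have h1 := Nat.mod_lt s hr
  have h2 := Nat.mod_lt s' hr
  rw [Nat.add_div hr, Nat.add_mod]
  split_ifs with h
  · have h3 : (s % r + s' % r) % r = s % r + s' % r - r := by
      rw [Nat.mod_eq_sub_mod h, Nat.mod_eq_of_lt (by omega)]
    rw [h3, mul_add, mul_add]
    omega
  · rw [Nat.mod_eq_of_lt (by omega : s % r + s' % r < r), add_zero, mul_add]
    omega

/-- If `y i` of the `r` symbols of group `i` are known, then `y i + q - r` is what `q` newcomers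
lose in this group; the total loss is largest when the known symbols fill whole groups. -/
theorem sum_excess_le {ι : Type*} {r q : ℕ} (hr : 0 < r) (hq : q ≤ r) (t : Finset ι) (y : ι → ℕ)
    (hy : ∀ i ∈ t, y i ≤ r) :
    ∑ i ∈ t, (y i + q - r) ≤ q * ((∑ i ∈ t, y i) / r) + ((∑ i ∈ t, y i) % r + q - r) := by
  classical
  induction t using Finset.induction_on with
  | empty => simp
  | insert a t ha ih =>
    rw [Finset.sum_insert ha, Finset.sum_insert ha]
    refine le_trans (add_le_add ?_ (ih fun i hi => hy i (Finset.mem_insert_of_mem hi)))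
      (div_add_excess_superadditive hr hq _ _)
    rcases (hy a (Finset.mem_insert_self _ _)).lt_or_eq with h | h
    · rw [Nat.div_eq_of_lt h, Nat.mod_eq_of_lt h]
      omega
    · rw [h, Nat.div_self hr, Nat.mod_self]
      omega

theorem sum_div_eq {r q : ℕ} (hr : 0 < r) (hq : q ≤ r) (t : ℕ) :
    ∑ i ∈ Finset.range q, (t + i) / r = q * (t / r) + (t % r + q - r) := by
  induction q with
  | zero =>
    have := Nat.mod_lt t hr
    simp
    omega
  | succ q ih =>
    rw [Finset.sum_range_succ, ih (by omega), Nat.add_div hr, Nat.div_eq_of_lt (by omega : q < r),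
      Nat.mod_eq_of_lt (by omega : q < r), Nat.succ_mul]
    have := Nat.mod_lt t hr
    split_ifs <;> omega

/-- The inequality behind the induction over the repair rounds. A class of rows of the received
matrix has `ν` groups of private symbols and one group of shared ones, `r` symbols in each group.
If `t` of these `(ν + 1) r` symbols are known, `x β` and `y` counting the unknown ones, then `q`
newcomers gain at least as much as the cut function grows from `t` to `t + q`. -/
theorem cut_slope_sum_le {r q ν t : ℕ} (hr : 0 < r) (hq : q ≤ r) (x : Fin ν → ℕ) (y : ℕ)
    (hx : ∀ β, x β ≤ r) (hy : y ≤ r) (h : ∑ β, x β + y + t = (ν + 1) * r) :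
    ∑ i ∈ Finset.range (t + q), min ν (ν + 1 - i / r) ≤
      ∑ i ∈ Finset.range t, min ν (ν + 1 - i / r) + min (∑ β, min (x β) q + y) (ν * q) := by
  rw [Finset.sum_range_add]
  refine Nat.add_le_add_left (le_min ?_ ?_) _
  · have h1 : ∑ i ∈ Finset.range q, min ν (ν + 1 - (t + i) / r) +
        ∑ i ∈ Finset.range q, (t + i) / r ≤ q * (ν + 1) := by
      rw [← Finset.sum_add_distrib]
      refine (Finset.sum_le_card_nsmul _ _ (ν + 1) fun i hi => ?_).trans (by simp)
      rw [Finset.mem_range] at hi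
      have : (t + i) / r < ν + 1 + 1 := by
        rw [Nat.div_lt_iff_lt_mul hr, Nat.succ_mul (ν + 1)]
        omega
      omega
    rw [sum_div_eq hr hq] at h1
    have h2 := sum_excess_le hr hq (Finset.univ : Finset (Option (Fin ν)))
      (fun o => r - o.elim y x) (fun _ _ => Nat.sub_le _ _)
    have h3 : ∑ o : Option (Fin ν), (r - o.elim y x) = t := by
      have h4 : ∑ o : Option (Fin ν), (r - o.elim y x) + ∑ o : Option (Fin ν), o.elim y x =
          (ν + 1) * r := by
        rw [← Finset.sum_add_distrib, Finset.sum_congr rfl (g := fun _ => r)]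
        · simp
        · rintro (_ | β) -
          · simp only [Option.elim]; omega
          · have := hx β
            simp only [Option.elim]; omega
      rw [Fintype.sum_option (f := fun o : Option (Fin ν) => o.elim y x)] at h4
      simp only [Option.elim] at h4 ⊢
      omega
    rw [h3, Fintype.sum_option] at h2
    have h5 : ∑ β, min (x β) q + ∑ β, (r - x β + q - r) = ν * q := by
      rw [← Finset.sum_add_distrib, Finset.sum_congr rfl (g := fun _ => q)]
      · simp
      · intro β _
        have := hx β
        omega
    simp only [Option.elim] at h2
    have h6 : q * (ν + 1) = ν * q + q := by ring
    omega
  · refine (Finset.sum_le_card_nsmul _ _ ν fun i _ => min_le_left _ _).trans ?_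
    simp [mul_comm]

/-! ### Generic messages -/

section GenericMessages

variable {K E H ρ β : Type*} [Field K] [AddCommGroup E] [Module K E]

/-- The span of a subspace `V₀` and the combinations, with coefficients `A`, of the symbols `w`. -/
def spanWith [Fintype H] [Fintype β] (V₀ : Submodule K E) (A : ρ → H → β → K) (w : H → β → E) :
    Submodule K E :=
  V₀ ⊔ Submodule.span K (Set.range fun i => ∑ h, ∑ b, A i h b • w h b)

variable [Fintype H] [Fintype β] [Fintype ρ]

theorem mem_spanWith {V₀ : Submodule K E} {A : ρ → H → β → K} {w : H → β → E} {x : E} :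
    x ∈ spanWith V₀ A w ↔ ∃ p ∈ V₀, ∃ μ : ρ → K,
      p + ∑ i, μ i • ∑ h, ∑ b, A i h b • w h b = x := by
  rw [spanWith, Submodule.mem_sup]
  constructor
  · rintro ⟨p, hp, z, hz, rfl⟩
    obtain ⟨μ, rfl⟩ := (Submodule.mem_span_range_iff_exists_fun K).1 hz
    exact ⟨p, hp, μ, rfl⟩
  · rintro ⟨p, hp, μ, rfl⟩
    exact ⟨p, hp, _, (Submodule.mem_span_range_iff_exists_fun K).2 ⟨μ, rfl⟩, rfl⟩

/-- Changing one symbol by `t • v` changes a combination of the received points by a multiple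
of `v`. -/
theorem sum_smul_update [DecidableEq H] [DecidableEq β] (A : ρ → H → β → K) (w : H → β → E)
    (h₀ : H) (b₀ : β) (v : E) (t : K) (μ : ρ → K) :
    ∑ i, μ i • ∑ h, ∑ b, A i h b • (w h b + if h = h₀ ∧ b = b₀ then t • v else 0) =
      ∑ i, μ i • ∑ h, ∑ b, A i h b • w h b + (t * ∑ i, μ i * A i h₀ b₀) • v := by
  have h1 : ∀ i, ∑ h, ∑ b, A i h b • (w h b + if h = h₀ ∧ b = b₀ then t • v else 0) =
      ∑ h, ∑ b, A i h b • w h b + (A i h₀ b₀ * t) • v := by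
    intro i
    simp only [smul_add, Finset.sum_add_distrib]
    congr 1
    rw [Finset.sum_eq_single h₀ (fun h _ hne => by simp [hne]) (by simp),
      Finset.sum_eq_single b₀ (fun b _ hne => by simp [hne]) (by simp)]
    simp [mul_smul]
  simp only [h1]
  simp only [smul_add, Finset.sum_add_distrib, smul_smul]
  congr 1
  rw [← Finset.sum_smul, Finset.mul_sum]
  congr 1
  exact Finset.sum_congr rfl fun i _ => by ring

/-- A generic choice of symbols `w h b` in the subspaces `V h`. Let `T` be the set of those `h`
for which `V h` ends up in the span `W` of `V₀` and the received combinations. Then no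
combination of the received points lies in a subspace generated by `V h`, `h ∈ T`, unless it
does not involve the symbols of any `h ∉ T`: a combination that does could be moved out of `W`
by moving one such symbol. -/
theorem exists_generic_messages [Finite E] [Fintype K] (hK : Fintype.card H + 1 < Fintype.card K)
    (V : H → Submodule K E) (V₀ : Submodule K E) (A : ρ → H → β → K) :
    ∃ w : H → β → E, (∀ h b, w h b ∈ V h) ∧ ∃ T : Finset H,
      (∀ h, h ∈ T ↔ V h ≤ spanWith V₀ A w) ∧
      ∀ μ : ρ → K, ∑ i, μ i • ∑ h, ∑ b, A i h b • w h b ∈ (⨆ h ∈ T, V h) →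
        ∀ h, h ∉ T → ∀ b, ∑ i, μ i * A i h b = 0 := by
  classical
  have := Module.Finite.of_finite (R := K) (M := E)
  -- maximize the dimension of the span, and then minimize the number of subspaces it contains
  let T : (H → β → E) → Finset H := fun w => {h | V h ≤ spanWith V₀ A w}
  let Ω := {w : H → β → E // ∀ h b, w h b ∈ V h}
  have : Nonempty Ω := ⟨⟨0, fun h b => zero_mem _⟩⟩
  obtain ⟨⟨w, hw⟩, hmax⟩ := Finite.exists_max (fun w : Ω =>
    (Fintype.card H + 1) * Module.finrank K (spanWith V₀ A w.1) +
      (Fintype.card H - (T w.1).card))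
  refine ⟨w, hw, T w, fun h => by simp [T], fun μ hμ h₀ hh₀ b₀ => ?_⟩
  by_contra hc
  set W := spanWith V₀ A w with hW
  have hh₀' : ¬ V h₀ ≤ W := by simpa [T] using hh₀
  obtain ⟨v, hv, hvW⟩ := SetLike.not_le_iff_exists.1 hh₀'
  let w' : K → H → β → E := fun t h b => w h b + if h = h₀ ∧ b = b₀ then t • v else 0
  have hw' : ∀ t h b, w' t h b ∈ V h := by
    intro t h b
    refine add_mem (hw h b) ?_
    split_ifs with hh
    · exact Submodule.smul_mem _ _ (hh.1 ▸ hv)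
    · exact zero_mem _
  have hmem : ∀ t x, x ∈ spanWith V₀ A (w' t) ↔ ∃ p ∈ V₀, ∃ μ : ρ → K,
      p + (∑ i, μ i • ∑ h, ∑ b, A i h b • w h b + (t * ∑ i, μ i * A i h₀ b₀) • v) = x := by
    intro t x
    simp only [mem_spanWith, w', sum_smul_update]
  -- the dimension stays the same, and `v` stays outside
  have hsup : ∀ t, W ⊔ Submodule.span K {v} ≤ spanWith V₀ A (w' t) ⊔ Submodule.span K {v} := by
    intro t
    refine sup_le (fun x hx => ?_) le_sup_right
    obtain ⟨p, hp, ν, rfl⟩ := mem_spanWith.1 hx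
    have h1 := (hmem t _).2 ⟨p, hp, ν, rfl⟩
    have h2 : p + ∑ i, ν i • ∑ h, ∑ b, A i h b • w h b =
        (p + (∑ i, ν i • ∑ h, ∑ b, A i h b • w h b + (t * ∑ i, ν i * A i h₀ b₀) • v)) +
          (-(t * ∑ i, ν i * A i h₀ b₀)) • v := by
      rw [neg_smul]; abel
    rw [h2]
    exact Submodule.add_mem_sup h1 (Submodule.smul_mem _ _ (Submodule.mem_span_singleton_self v))
  have hle : ∀ U : Submodule K E, Module.finrank K (U ⊔ Submodule.span K {v} : Submodule K E) ≤
      Module.finrank K U + 1 := by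
    intro U
    refine (Submodule.finrank_add_le_finrank_add_finrank _ _).trans (Nat.add_le_add_left ?_ _)
    exact (finrank_span_le_card ({v} : Set E)).trans (by simp)
  have hlt : Module.finrank K W + 1 ≤
      Module.finrank K (W ⊔ Submodule.span K {v} : Submodule K E) := by
    refine Submodule.finrank_lt_finrank_of_lt (lt_of_le_of_ne le_sup_left fun heq => hvW ?_)
    rw [heq]
    exact Submodule.mem_sup_right (Submodule.mem_span_singleton_self v)
  have hdim : ∀ t, Module.finrank K (spanWith V₀ A (w' t)) ≤ Module.finrank K W := by
    intro t
    by_contra hgt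
    have h1 := hmax ⟨w' t, hw' t⟩
    simp only at h1
    have h2 : (Fintype.card H + 1) * (Module.finrank K W + 1) ≤
      (Fintype.card H + 1) * Module.finrank K (spanWith V₀ A (w' t)) :=
      Nat.mul_le_mul_left _ (by omega)
    rw [mul_add, mul_one] at h2
    omega
  have hdim' : ∀ t, Module.finrank K W ≤ Module.finrank K (spanWith V₀ A (w' t)) := by
    intro t
    have h1 := Submodule.finrank_mono (hsup t)
    have h2 := hle (spanWith V₀ A (w' t))
    omega
  have hvt : ∀ t, v ∉ spanWith V₀ A (w' t) := by
    intro t hvt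
    have h1 : spanWith V₀ A (w' t) ⊔ Submodule.span K {v} = spanWith V₀ A (w' t) :=
      sup_eq_left.2 ((Submodule.span_singleton_le_iff_mem _ _).2 hvt)
    have h2 := Submodule.finrank_mono (hsup t)
    rw [h1] at h2
    have h3 := hdim t
    omega
  -- for some `t ≠ 0` no new subspace is swallowed
  obtain ⟨t, ht0, ht⟩ : ∃ t : K, t ≠ 0 ∧ T (w' t) ⊆ T w := by
    by_contra hno
    push Not at hno
    have h1 : ∀ t : {t : K // t ≠ 0}, ∃ h, h ∈ T (w' t) ∧ h ∉ T w := fun t =>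
      Finset.not_subset.1 (hno t.1 t.2)
    choose f hf hf' using h1
    obtain ⟨s, t, hst, hfe⟩ := Fintype.exists_ne_map_eq_of_card_lt f (by
      rw [Fintype.card_subtype_compl]
      simp
      omega)
    have hVs : V (f s) ≤ spanWith V₀ A (w' s) := by simpa [T] using hf s
    have hVt : V (f s) ≤ spanWith V₀ A (w' t) := by rw [hfe]; simpa [T] using hf t
    have hVW : ¬ V (f s) ≤ W := by simpa [T] using hf' s
    obtain ⟨u, hu, huW⟩ := SetLike.not_le_iff_exists.1 hVW
    obtain ⟨p, hp, κ, hκ⟩ := (hmem _ _).1 (hVs hu)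
    obtain ⟨p', hp', κ', hκ'⟩ := (hmem _ _).1 (hVt hu)
    set x := p + ∑ i, κ i • ∑ h, ∑ b, A i h b • w h b with hx
    set x' := p' + ∑ i, κ' i • ∑ h, ∑ b, A i h b • w h b with hx'
    set α := ∑ i, κ i * A i h₀ b₀ with hα
    set α' := ∑ i, κ' i * A i h₀ b₀ with hα'
    have hxW : x ∈ W := mem_spanWith.2 ⟨p, hp, κ, rfl⟩
    have hxW' : x' ∈ W := mem_spanWith.2 ⟨p', hp', κ', rfl⟩
    have e1 : x + (s.1 * α) • v = u := by rw [hx, ← hκ]; abel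
    have e2 : x' + (t.1 * α') • v = u := by rw [hx', ← hκ']; abel
    have key : ∀ (U : Submodule K E) (a : K), v ∉ U → a • v ∈ U → a = 0 := by
      intro U a hvU haU
      by_contra ha
      exact hvU ((Submodule.smul_mem_iff _ ha).1 haU)
    have e3 : s.1 * α - t.1 * α' = 0 := by
      refine key W _ hvW ?_
      have : (s.1 * α - t.1 * α') • v = x' - x := by
        rw [sub_smul, sub_eq_sub_iff_add_eq_add, add_comm, e1, add_comm, ← e2]
        abel
      rw [this]
      exact sub_mem hxW' hxW
    have e4 : x = x' := by
      have : x + (s.1 * α) • v = x' + (s.1 * α) • v := by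
        rw [e1, ← e2, sub_eq_zero.1 e3]
      exact add_right_cancel this
    have e5 : s.1 * (α - α') = 0 := by
      refine key (spanWith V₀ A (w' s)) _ (hvt s)
        ((hmem _ _).2 ⟨p - p', sub_mem hp hp', κ - κ', ?_⟩)
      have h2 : p - p' + ∑ i, (κ - κ') i • ∑ h, ∑ b, A i h b • w h b = x - x' := by
        simp only [Pi.sub_apply, sub_smul, Finset.sum_sub_distrib, hx, hx']
        abel
      have h3 : ∑ i, (κ - κ') i * A i h₀ b₀ = α - α' := by
        simp only [Pi.sub_apply, sub_mul, Finset.sum_sub_distrib, hα, hα']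
      rw [← add_assoc, h2, h3, e4, sub_self, zero_add]
    have e6 : α = α' := sub_eq_zero.1 ((mul_eq_zero.1 e5).resolve_left s.2)
    have e7 : α = 0 := by
      rw [← e6, ← sub_mul] at e3
      refine (mul_eq_zero.1 e3).resolve_left fun h => hst (Subtype.ext (sub_eq_zero.1 h))
    rw [e7, mul_zero, zero_smul, add_zero] at e1
    exact huW (e1 ▸ hxW)
  have hTeq : T (w' t) = T w := by
    refine Finset.eq_of_subset_of_card_le ht ?_
    have h1 := hmax ⟨w' t, hw' t⟩
    simp only [le_antisymm (hdim t) (hdim' t)] at h1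
    have h2 := Finset.card_le_univ (T w)
    have h3 := Finset.card_le_univ (T (w' t))
    omega
  have hVT : (⨆ h ∈ T w, V h) ≤ spanWith V₀ A (w' t) := by
    refine iSup₂_le fun h hh => ?_
    rw [← hTeq] at hh
    simpa [T] using hh
  have h1 : ∑ i, μ i • ∑ h, ∑ b, A i h b • w h b + (t * ∑ i, μ i * A i h₀ b₀) • v ∈
      spanWith V₀ A (w' t) := (hmem _ _).2 ⟨0, zero_mem _, μ, by rw [zero_add]⟩
  have h2 := (Submodule.add_mem_iff_right _ (hVT hμ)).1 h1
  exact hvt t ((Submodule.smul_mem_iff _ (mul_ne_zero ht0 hc)).1 h2)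

/-- Vectors `z i`, `i ∈ I`, of `W` that are independent modulo `U ≤ W` enlarge the dimension. -/
theorem finrank_add_card_le [FiniteDimensional K E] {U W : Submodule K E} (hUW : U ≤ W)
    (I : Finset ρ) (z : ρ → E) (hz : ∀ i, z i ∈ W)
    (hI : ∀ μ : ρ → K, (∀ i ∉ I, μ i = 0) → ∑ i, μ i • z i ∈ U → μ = 0) :
    Module.finrank K U + I.card ≤ Module.finrank K W := by
  classical
  let φ : U × (I → K) →ₗ[K] E :=
    U.subtype.coprod (Fintype.linearCombination K (fun i : I => z i))
  have hφ : ∀ x, φ x ∈ W := by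
    rintro ⟨u, μ⟩
    simp only [φ, LinearMap.coprod_apply, Fintype.linearCombination_apply]
    exact add_mem (hUW u.2) (sum_mem fun i _ => Submodule.smul_mem _ _ (hz i))
  have hinj : Function.Injective (φ.codRestrict W hφ) := by
    refine (injective_iff_map_eq_zero _).2 ?_
    rintro ⟨u, μ⟩ h
    have h1 : (u : E) + ∑ i : I, μ i • z i = 0 := by
      simpa [φ, Fintype.linearCombination_apply] using congrArg Subtype.val h
    let ν : ρ → K := fun i => if h : i ∈ I then μ ⟨i, h⟩ else 0
    have h2 : ∑ i, ν i • z i = ∑ i : I, μ i • z i := by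
      rw [← Finset.sum_subset (Finset.subset_univ I) (fun i _ hi => by simp [ν, hi]),
        ← Finset.sum_coe_sort]
      exact Finset.sum_congr rfl fun i _ => by simp [ν]
    have h3 : ν = 0 := hI ν (fun i hi => by simp [ν, hi]) (by
      rw [h2, eq_neg_of_add_eq_zero_right h1]
      exact neg_mem u.2)
    have h4 : μ = 0 := funext fun i => by
      have := congrFun h3 i
      simpa [ν] using this
    subst h4
    simp only [Pi.zero_apply, zero_smul, Finset.sum_const_zero, add_zero] at h1
    ext
    · exact h1
    · rfl
  have := LinearMap.finrank_le_finrank_of_injective hinj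
  simpa using this

end GenericMessages

/-! ### Mixing matrices -/

theorem exists_injOn_of_card_le {α β : Type*} [Nonempty β] (A : Finset α) (t : Finset β)
    (h : A.card ≤ t.card) : ∃ f : α → β, Set.InjOn f A ∧ ∀ a ∈ A, f a ∈ t := by
  classical
  obtain ⟨g⟩ : Nonempty (A ↪ t) := Function.Embedding.nonempty_of_card_le (by simpa using h)
  refine ⟨fun a => if h : a ∈ A then (g ⟨a, h⟩ : β) else Classical.arbitrary β, ?_, ?_⟩
  · intro a ha b hb hab
    simp only [Finset.mem_coe] at ha hb
    simp only [ha, hb, dif_pos] at hab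
    simpa using g.injective (Subtype.ext hab)
  · intro a ha
    simp [ha]

/-- A class of rows of the received matrix consists of one row in each of `ν` blocks. Its symbols
are the private ones `inl b` of each row and the shared ones `inr b`; suppose that of these
`X β` and `Y` are unknown. Every newcomer in `Q` forms one combination of each row. These
`ν |Q|` combinations can be matched with unknown symbols that occur in them, up to the obvious
bound. Here `τ` is the matching, and `I` the set of matched combinations. -/
theorem exists_matching {ν r : ℕ} (hr : 0 < r) (Q : Finset (Fin r)) (X : Fin ν → Finset (Fin r))
    (Y : Finset (Fin r)) :
    ∃ (I : Finset (Fin ν × Fin r)) (τ : Fin ν × Fin r → Fin r ⊕ Fin r), (∀ p ∈ I, p.2 ∈ Q) ∧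
      min (∑ β, min (X β).card Q.card + Y.card) (ν * Q.card) ≤ I.card ∧
      (∀ p ∈ I, ∀ b, τ p = Sum.inl b → b ∈ X p.1) ∧
      (∀ p ∈ I, ∀ b, τ p = Sum.inr b → b ∈ Y) ∧
      (∀ p ∈ I, ∀ p' ∈ I, ∀ b, τ p = Sum.inl b → τ p' = Sum.inl b → p.1 = p'.1 → p = p') ∧
      ∀ p ∈ I, ∀ p' ∈ I, ∀ b, τ p = Sum.inr b → τ p' = Sum.inr b → p = p' := by
  classical
  have : Nonempty (Fin r) := ⟨⟨0, hr⟩⟩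
  have h1 : ∀ β, ∃ A ⊆ Q, A.card = min (X β).card Q.card := fun β =>
    Finset.exists_subset_card_eq (min_le_right _ _)
  choose A hAQ hA using h1
  have h2 : ∀ β, ∃ f : Fin r → Fin r, Set.InjOn f (A β) ∧ ∀ a ∈ A β, f a ∈ X β := fun β =>
    exists_injOn_of_card_le _ _ ((hA β).trans_le (min_le_left _ _))
  choose f hf hfX using h2
  let P : Finset (Fin ν × Fin r) := {p | p.2 ∈ A p.1}
  let R : Finset (Fin ν × Fin r) := {p | p.2 ∈ Q ∧ p.2 ∉ A p.1}
  have hP : P.card = ∑ β, min (X β).card Q.card := by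
    have : P = (Finset.univ.sigma A).map (Equiv.sigmaEquivProd (Fin ν) (Fin r)).toEmbedding := by
      ext ⟨β, j⟩
      simp [P]
    rw [this, Finset.card_map, Finset.card_sigma]
    exact Finset.sum_congr rfl fun β _ => hA β
  have hPR : P.card + R.card = ν * Q.card := by
    rw [← Finset.card_union_of_disjoint]
    · have : P ∪ R = Finset.univ ×ˢ Q := by
        ext ⟨β, j⟩
        simp only [P, R, Finset.mem_union, Finset.mem_filter, Finset.mem_univ, true_and,
          Finset.mem_product]
        have := @hAQ β j
        tauto
      rw [this, Finset.card_product]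
      simp
    · rw [Finset.disjoint_left]
      intro p hp hp'
      simp only [P, R, Finset.mem_filter] at hp hp'
      exact hp'.2.2 hp.2
  obtain ⟨J, hJR, hJ⟩ := Finset.exists_subset_card_eq (s := R) (min_le_right Y.card R.card)
  obtain ⟨g, hg, hgY⟩ := exists_injOn_of_card_le J Y (hJ.trans_le (min_le_left _ _))
  have hJP : ∀ p ∈ J, p ∉ P := by
    intro p hp hp'
    have := hJR hp
    simp only [P, R, Finset.mem_filter] at this hp'
    exact this.2.2 hp'.2
  have hτ : ∀ p ∈ P ∪ J, p ∉ P → p ∈ J := fun p hp hp' =>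
    (Finset.mem_union.1 hp).resolve_left hp'
  refine ⟨P ∪ J, fun p => if p ∈ P then Sum.inl (f p.1 p.2) else Sum.inr (g p), ?_, ?_, ?_, ?_, ?_,
    ?_⟩
  · intro p hp
    rcases Finset.mem_union.1 hp with hp | hp
    · simp only [P, Finset.mem_filter] at hp
      exact hAQ _ hp.2
    · have := hJR hp
      simp only [R, Finset.mem_filter] at this
      exact this.2.1
  · rw [Finset.card_union_of_disjoint (Finset.disjoint_right.2 hJP), hJ, ← hPR, hP]
    omega
  · intro p hp b hb
    by_cases h : p ∈ P
    · simp only [h, if_true, Sum.inl.injEq] at hb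
      rw [← hb]
      simp only [P, Finset.mem_filter] at h
      exact hfX _ _ h.2
    · simp [h] at hb
  · intro p hp b hb
    by_cases h : p ∈ P
    · simp [h] at hb
    · simp only [h, if_false, Sum.inr.injEq] at hb
      rw [← hb]
      exact hgY _ (hτ p hp h)
  · rintro ⟨β, j⟩ hp ⟨β', j'⟩ hp' b hb hb' hβ
    obtain rfl : β = β' := hβ
    by_cases h : (β, j) ∈ P
    · by_cases h' : (β, j') ∈ P
      · simp only [h, h', if_true, Sum.inl.injEq] at hb hb'
        simp only [P, Finset.mem_filter] at h h'
        rw [hf β h.2 h'.2 (hb.trans hb'.symm)]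
      · simp [h'] at hb'
    · simp [h] at hb
  · intro p hp p' hp' b hb hb'
    by_cases h : p ∈ P
    · simp [h] at hb
    · by_cases h' : p' ∈ P
      · simp [h'] at hb'
      · simp only [h, h', if_false, Sum.inr.injEq] at hb hb'
        exact hg (hτ p hp h) (hτ p' hp' h') (hb.trans hb'.symm)

/-- Mixing matrices `M β`, one for each of `ν` blocks, are generic if for every class of rows of
the received matrix, for every set `Q` of newcomers and for all sets `X β`, `Y` of unknown private
and shared symbols, as many combinations as possible are independent in the unknown symbols. -/
def MixGeneric {K : Type*} [Field K] (ν : ℕ) {r : ℕ}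
    (M : ℕ → Matrix (Fin r ⊕ Fin r) (Fin r) K) : Prop :=
  ∀ (Q : Finset (Fin r)) (X : Fin ν → Finset (Fin r)) (Y : Finset (Fin r)),
    ∃ I : Finset (Fin ν × Fin r), (∀ p ∈ I, p.2 ∈ Q) ∧
      min (∑ β, min (X β).card Q.card + Y.card) (ν * Q.card) ≤ I.card ∧
      ∀ l : Fin ν × Fin r → K, (∀ p ∉ I, l p = 0) →
        (∀ β, ∀ b ∈ X β, ∑ j, l (β, j) * M β (Sum.inl b) j = 0) →
        (∀ b ∈ Y, ∑ p, l p * M p.1 (Sum.inr b) p.2 = 0) → l = 0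

/-- For `r = 1` the matrix with entries `1` is generic in all blocks at once: only one matched
combination involves the shared symbol. -/
theorem mixGeneric_one {K : Type*} [Field K] (ν : ℕ) :
    MixGeneric ν (fun _ => (Matrix.of fun _ _ => 1 : Matrix (Fin 1 ⊕ Fin 1) (Fin 1) K)) := by
  intro Q X Y
  obtain ⟨I, τ, hQ, hI, h1, h2, h3, h4⟩ := exists_matching one_pos Q X Y
  refine ⟨I, hQ, hI, fun l hl hX hY => ?_⟩
  have hpriv : ∀ p b, τ p = Sum.inl b → l p = 0 := by
    intro p b hb
    by_cases hp : p ∈ I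
    · have := hX p.1 b (h1 p hp b hb)
      simpa [Subsingleton.elim (0 : Fin 1) p.2] using this
    · exact hl p hp
  funext p
  by_cases hp : p ∈ I
  · cases hτ : τ p with
    | inl b => exact hpriv p b hτ
    | inr b =>
      have := hY b (h2 p hp b hτ)
      rw [Finset.sum_eq_single p (fun p' _ hne => ?_) (by simp)] at this
      · simpa using this
      · by_cases hp' : p' ∈ I
        · cases hτ' : τ p' with
          | inl b' => simp [hpriv p' b' hτ']
          | inr b' =>
            obtain rfl := Subsingleton.elim b b'
            exact absurd (h4 p' hp' p hp b hτ' hτ) hne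
        · simp [hl p' hp']
  · exact hl p hp

theorem isMDS_fromCols_one {K : Type*} [Field K] :
    IsMDS (Matrix.fromCols (1 : Matrix (Fin 1 ⊕ Fin 1) (Fin 1 ⊕ Fin 1) K)
      (Matrix.of fun _ _ => 1 : Matrix (Fin 1 ⊕ Fin 1) (Fin 1) K)) := by
  intro s hs
  rw [Fintype.linearIndependent_iff]
  intro g hg
  have e1 := congrFun hg (Sum.inl 0)
  have e2 := congrFun hg (Sum.inr 0)
  have hne : s (Sum.inl 0) ≠ s (Sum.inr 0) := fun h => by simpa using hs h
  simp only [Fintype.sum_sum_type, Finset.univ_unique, Fin.default_eq_zero, Fin.isValue,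
    Finset.sum_singleton, Pi.add_apply, Pi.smul_apply, Matrix.col_apply, smul_eq_mul,
    Pi.zero_apply] at e1 e2
  have key : g (Sum.inl 0) = 0 ∧ g (Sum.inr 0) = 0 := by
    rcases h1 : s (Sum.inl 0) with (a | a) | a <;> rcases h2 : s (Sum.inr 0) with (b | b) | b <;>
      obtain rfl := Subsingleton.elim 0 a <;> obtain rfl := Subsingleton.elim 0 b <;>
      simp_all [Matrix.fromCols]
  rintro (i | i)
  · rw [Subsingleton.elim i 0]; exact key.1
  · rw [Subsingleton.elim i 0]; exact key.2

section GenericMixing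

variable {K : Type*} [Field K] {ν r : ℕ}

/-- The column of a symbol in the rows of block `β`, among the unknown symbols `X`, `Y`. -/
def unknownColumn (K : Type*) [Field K] (X : Fin ν → Finset (Fin r)) (Y : Finset (Fin r))
    (β : Fin ν) (c : Fin r ⊕ Fin r) : (Fin ν × Fin r) ⊕ Fin r → K
  | Sum.inl (β', b) => if c = Sum.inl b then if β = β' ∧ b ∈ X β then 1 else 0 else 0
  | Sum.inr b => if c = Sum.inr b then if b ∈ Y then 1 else 0 else 0

theorem sum_unknownColumn_inl (X : Fin ν → Finset (Fin r)) (Y : Finset (Fin r)) (β : Fin ν)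
    (y : Fin r ⊕ Fin r → K) (β' : Fin ν) (b : Fin r) :
    (∑ c, y c • unknownColumn K X Y β c) (Sum.inl (β', b)) =
      if β = β' ∧ b ∈ X β then y (Sum.inl b) else 0 := by
  simp only [Finset.sum_apply, Pi.smul_apply, smul_eq_mul, unknownColumn]
  rw [Finset.sum_eq_single (Sum.inl b) (fun c _ hne => by simp [hne]) (by simp)]
  simp

theorem sum_unknownColumn_inr (X : Fin ν → Finset (Fin r)) (Y : Finset (Fin r)) (β : Fin ν)
    (y : Fin r ⊕ Fin r → K) (b : Fin r) :
    (∑ c, y c • unknownColumn K X Y β c) (Sum.inr b) = if b ∈ Y then y (Sum.inr b) else 0 := by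
  simp only [Finset.sum_apply, Pi.smul_apply, smul_eq_mul, unknownColumn]
  rw [Finset.sum_eq_single (Sum.inr b) (fun c _ hne => by simp [hne]) (by simp)]
  simp

/-- The condition of `MixGeneric` for one choice of `Q`, `X`, `Y`; `x (β, c, j)` is the entry
`(c, j)` of the mixing matrix of block `β`. -/
theorem holdsOffHypersurface_mix_rows (hr : 0 < r) (Q : Finset (Fin r))
    (X : Fin ν → Finset (Fin r)) (Y : Finset (Fin r)) :
    HoldsOffHypersurface (ν * r) (fun x : Fin ν × (Fin r ⊕ Fin r) × Fin r → K =>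
      ∃ I : Finset (Fin ν × Fin r), (∀ p ∈ I, p.2 ∈ Q) ∧
      min (∑ β, min (X β).card Q.card + Y.card) (ν * Q.card) ≤ I.card ∧
      ∀ l : Fin ν × Fin r → K, (∀ p ∉ I, l p = 0) →
        (∀ β, ∀ b ∈ X β, ∑ j, l (β, j) * x (β, Sum.inl b, j) = 0) →
        (∀ b ∈ Y, ∑ p, l p * x (p.1, Sum.inr b, p.2) = 0) → l = 0) := by
  classical
  obtain ⟨I, τ, hQ, hI, h1, h2, h3, h4⟩ := exists_matching hr Q X Y
  let u : I → Fin ν × (Fin r ⊕ Fin r) × Fin r → (Fin ν × Fin r) ⊕ Fin r → K := fun p e =>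
    if e.1 = p.1.1 ∧ e.2.2 = p.1.2 then unknownColumn K X Y p.1.1 e.2.1 else 0
  have hu : ∀ (x : Fin ν × (Fin r ⊕ Fin r) × Fin r → K) (p : I),
      0 + ∑ e, x e • u p e = ∑ c, x (p.1.1, c, p.1.2) • unknownColumn K X Y p.1.1 c := by
    intro x p
    rw [zero_add, Fintype.sum_prod_type,
      Finset.sum_eq_single p.1.1 (fun β _ hne => by simp [u, hne]) (by simp), Fintype.sum_prod_type]
    refine Finset.sum_congr rfl fun c _ => ?_
    rw [Finset.sum_eq_single p.1.2 (fun β _ hne => by simp [u, hne]) (by simp)]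
    simp [u]
  -- the witness: each combination consists of the symbol it is matched with
  let x₀ : Fin ν × (Fin r ⊕ Fin r) × Fin r → K := fun e => if τ (e.1, e.2.2) = e.2.1 then 1 else 0
  have hx₀ : ∀ p : I, ∑ c, x₀ (p.1.1, c, p.1.2) • unknownColumn K X Y p.1.1 c =
      unknownColumn K X Y p.1.1 (τ p) := by
    intro p
    rw [Finset.sum_eq_single (τ p) (fun c _ hne => by simp [x₀, hne.symm]) (by simp)]
    simp [x₀]
  let col : I → (Fin ν × Fin r) ⊕ Fin r := fun p =>
    (τ p).elim (fun b => Sum.inl (p.1.1, b)) Sum.inr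
  have hcol : ∀ p : I, unknownColumn K X Y p.1.1 (τ p) = Pi.single (col p) 1 := by
    intro p
    cases hτ : τ p with
    | inl b =>
      have := h1 p p.2 b hτ
      ext (⟨β', b'⟩ | b')
      · simp only [unknownColumn, col, hτ, Sum.elim_inl, Pi.single_apply, Sum.inl.injEq,
          Prod.mk.injEq]
        grind
      · simp [unknownColumn, col, hτ]
    | inr b =>
      have := h2 p p.2 b hτ
      ext (⟨β', b'⟩ | b')
      · simp [unknownColumn, col, hτ]
      · simp only [unknownColumn, col, hτ, Sum.elim_inr, Pi.single_apply, Sum.inr.injEq]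
        grind
  have hinj : Function.Injective col := by
    intro p p' h
    refine Subtype.ext ?_
    cases hτ : τ p with
    | inl b =>
      cases hτ' : τ p' with
      | inl b' =>
        simp only [col, hτ, hτ', Sum.elim_inl, Sum.inl.injEq, Prod.mk.injEq] at h
        obtain ⟨h, rfl⟩ := h
        exact h3 p p.2 p' p'.2 b hτ hτ' h
      | inr b' => simp [col, hτ, hτ'] at h
    | inr b =>
      cases hτ' : τ p' with
      | inl b' => simp [col, hτ, hτ'] at h
      | inr b' =>
        simp only [col, hτ, hτ', Sum.elim_inr, Sum.inr.injEq] at h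
        subst h
        exact h4 p p.2 p' p'.2 b hτ hτ'
  have hli : LinearIndependent K (fun p : I => (0 : (Fin ν × Fin r) ⊕ Fin r → K) +
      ∑ e, x₀ e • u p e) := by
    simp only [hu, hx₀, hcol]
    have := (Pi.basisFun K ((Fin ν × Fin r) ⊕ Fin r)).linearIndependent.comp col hinj
    convert this using 1
    ext p
    simp
  refine (HoldsOffHypersurface.linearIndependent (fun _ => 0) u x₀ hli).mono ?_ ?_
  · have := Finset.card_le_univ I
    simpa using this
  · intro x hx
    refine ⟨I, hQ, hI, fun l hl hX hY => ?_⟩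
    simp only [hu] at hx
    rw [Fintype.linearIndependent_iff] at hx
    have h5 := hx (fun p => l p) (by
      have h6 : ∑ p : I, l p • ∑ c, x (p.1.1, c, p.1.2) • unknownColumn K X Y p.1.1 c =
          ∑ p, l p • ∑ c, x (p.1, c, p.2) • unknownColumn K X Y p.1 c := by
        rw [Finset.sum_coe_sort I
          (fun p => l p • ∑ c, x (p.1, c, p.2) • unknownColumn K X Y p.1 c)]
        exact Finset.sum_subset (Finset.subset_univ I) fun p _ hp => by simp [hl p hp]
      rw [h6]
      funext a
      rw [Finset.sum_apply, Pi.zero_apply]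
      rcases a with ⟨β, b⟩ | b
      · simp only [Pi.smul_apply, sum_unknownColumn_inl, smul_eq_mul]
        by_cases hb : b ∈ X β
        · refine Eq.trans ?_ (hX β b hb)
          rw [Fintype.sum_prod_type,
            Finset.sum_eq_single β (fun β' _ hne => by simp [hne]) (by simp)]
          simp [hb]
        · refine Finset.sum_eq_zero fun p _ => ?_
          rw [if_neg, mul_zero]
          rintro ⟨rfl, h⟩
          exact hb h
      · simp only [Pi.smul_apply, sum_unknownColumn_inr, smul_eq_mul]
        by_cases hb : b ∈ Y
        · simpa [hb] using hY b hb
        · simp [hb])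
    funext p
    by_cases hp : p ∈ I
    · exact h5 ⟨p, hp⟩
    · exact hl p hp

/-- Independence of the columns `s` of `[I M]`, for a generic mixing matrix `M`. The witness
completes the identity columns among them to a permutation matrix. -/
theorem holdsOffHypersurface_mix_mds (β : Fin ν)
    (s : Fin r ⊕ Fin r → (Fin r ⊕ Fin r) ⊕ Fin r) (hs : Function.Injective s) :
    HoldsOffHypersurface (r + r) (fun x : Fin ν × (Fin r ⊕ Fin r) × Fin r → K =>
      LinearIndependent K (fun c =>
        (Matrix.fromCols (1 : Matrix (Fin r ⊕ Fin r) (Fin r ⊕ Fin r) K)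
          (Matrix.of fun c j => x (β, c, j))).col (s c))) := by
  classical
  -- a permutation `π` extending the part of `s` with values in the identity columns
  obtain ⟨π, hπ⟩ : ∃ π : Equiv.Perm (Fin r ⊕ Fin r), ∀ c c', s c = Sum.inl c' → π c = c' := by
    let f : {c : Fin r ⊕ Fin r // (s c).isLeft} → Fin r ⊕ Fin r := fun c => (s c).getLeft c.2
    have hf : Function.Injective f := by
      intro c c' h
      refine Subtype.ext (hs ?_)
      rw [← Sum.inl_getLeft (s c) c.2, ← Sum.inl_getLeft (s c') c'.2]
      exact congrArg Sum.inl h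
    let e := Equiv.ofInjective f hf
    refine ⟨e.extendSubtype, fun c c' h => ?_⟩
    rw [Equiv.extendSubtype_apply_of_mem e c (by simp [h])]
    simp [e, f, h]
  let cc : Fin r ⊕ Fin r → Fin r ⊕ Fin r → K := fun c => (s c).elim (fun c' => Pi.single c' 1) 0
  let u : Fin r ⊕ Fin r → Fin ν × (Fin r ⊕ Fin r) × Fin r → Fin r ⊕ Fin r → K := fun c e =>
    if e.1 = β ∧ s c = Sum.inr e.2.2 then Pi.single e.2.1 1 else 0
  have hu : ∀ (x : Fin ν × (Fin r ⊕ Fin r) × Fin r → K) (c : Fin r ⊕ Fin r),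
      cc c + ∑ e, x e • u c e =
        (Matrix.fromCols (1 : Matrix (Fin r ⊕ Fin r) (Fin r ⊕ Fin r) K)
          (Matrix.of fun c j => x (β, c, j))).col (s c) := by
    intro x c
    rw [Fintype.sum_prod_type, Finset.sum_eq_single β (fun β _ hne => by simp [u, hne])
      (by simp), Fintype.sum_prod_type]
    cases h : s c with
    | inl c' =>
      funext a
      simp [cc, u, h, Pi.single_apply, Matrix.one_apply]
    | inr j =>
      have h1 : ∀ a, ∑ j', x (β, a, j') • u c (β, a, j') = x (β, a, j) • Pi.single a 1 := by
        intro a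
        simp [u, h]
      simp only [h1]
      funext a
      simp [cc, h, Pi.single_apply, -Fintype.sum_sum_type]
  let x₀ : Fin ν × (Fin r ⊕ Fin r) × Fin r → K := fun e =>
    if ∃ c, s c = Sum.inr e.2.2 ∧ π c = e.2.1 then 1 else 0
  have hx₀ : ∀ c, cc c + ∑ e, x₀ e • u c e = Pi.single (π c) 1 := by
    intro c
    rw [hu]
    funext a
    cases h : s c with
    | inl c' => simp [hπ c c' h, Pi.single_apply, Matrix.one_apply]
    | inr j =>
      simp only [x₀, Matrix.col_apply, Matrix.fromCols_apply_inr, Matrix.of_apply, Pi.single_apply]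
      congr 1
      refine propext ⟨?_, fun h' => ⟨c, h, h'.symm⟩⟩
      rintro ⟨c', h1, h2⟩
      rw [← h2, hs (h1.trans h.symm)]
  have hli : LinearIndependent K (fun c => cc c + ∑ e, x₀ e • u c e) := by
    simp only [hx₀]
    have := (Pi.basisFun K (Fin r ⊕ Fin r)).linearIndependent.comp π π.injective
    convert this using 1
    ext p
    simp
  refine (HoldsOffHypersurface.linearIndependent cc u x₀ hli).mono (by simp) fun x hx => ?_
  simpa only [hu] using hx

/-- Over a sufficiently large finite field there are generic mixing matrices, and for `r = 1` a
single one suffices. -/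
theorem exists_mixGeneric (hr : 0 < r) (hν : 0 < ν) : ∃ D : ℕ, ∀ (K : Type) [Field K] [Fintype K],
    D < Fintype.card K → ∃ M : ℕ → Matrix (Fin r ⊕ Fin r) (Fin r) K,
      (r = 1 → ∀ b, M b = M 0) ∧
      (∀ b, IsMDS (Matrix.fromCols (1 : Matrix (Fin r ⊕ Fin r) (Fin r ⊕ Fin r) K) (M b))) ∧
      MixGeneric ν M := by
  by_cases h1 : r = 1
  · subst h1
    exact ⟨0, fun K _ _ _ => ⟨_, fun _ _ => rfl, fun _ => isMDS_fromCols_one, mixGeneric_one ν⟩⟩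
  · refine ⟨Fintype.card (Finset (Fin r) × (Fin ν → Finset (Fin r)) × Finset (Fin r)) * (ν * r) +
      Fintype.card (Fin ν × (Fin r ⊕ Fin r ↪ (Fin r ⊕ Fin r) ⊕ Fin r)) * (r + r),
      fun K _ _ hK => ?_⟩
    · have g1 := HoldsOffHypersurface.forall_fintype
        (fun q : Finset (Fin r) × (Fin ν → Finset (Fin r)) × Finset (Fin r) =>
          holdsOffHypersurface_mix_rows (K := K) hr q.1 q.2.1 q.2.2)
      have g2 := HoldsOffHypersurface.forall_fintype
        (fun q : Fin ν × (Fin r ⊕ Fin r ↪ (Fin r ⊕ Fin r) ⊕ Fin r) =>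
          holdsOffHypersurface_mix_mds (K := K) q.1 q.2 q.2.injective)
      obtain ⟨x, hx1, hx2⟩ := (g1.and g2).exists_point hK
      have hmod : ∀ β : Fin ν, (⟨(β : ℕ) % ν, Nat.mod_lt _ hν⟩ : Fin ν) = β := fun β =>
        Fin.ext (Nat.mod_eq_of_lt β.2)
      refine ⟨fun b => Matrix.of fun c j => x (⟨b % ν, Nat.mod_lt _ hν⟩, c, j),
        fun h => absurd h h1, fun b s hs => hx2 (⟨b % ν, Nat.mod_lt _ hν⟩, ⟨s, hs⟩),
        fun Q X Y => ?_⟩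
      simp only [Matrix.of_apply, hmod]
      exact hx1 (Q, X, Y)

end GenericMixing

/-! ### The rows of a repair round -/

section Rows

variable {n r ν : ℕ} {K : Type*} [Field K]

/-- The coefficient of the symbol sent by helper `h` for newcomer `b` in the point that
newcomer `j` computes from row `a` of the received matrix, where `p = (a, j)`. -/
def rowCoeff (n : ℕ) {r : ℕ} {K : Type*} [Field K] (M : ℕ → Matrix (Fin r ⊕ Fin r) (Fin r) K)
    (p : Fin (n - 2 * r) × Fin r) : Fin (n - 2 * r) ⊕ Fin r → Fin r → K
  | Sum.inl h, b =>
    if ((p.1 + b : ℕ) % (n - 2 * r)) = h then M ((p.1 : ℕ) / r) (Sum.inl b) p.2 else 0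
  | Sum.inr h, b => if ((p.1 + b : ℕ) % r) = h then M ((p.1 : ℕ) / r) (Sum.inr b) p.2 else 0

theorem repairRound_newcomer {L : Type*} [Field L] [Algebra K L] (C : RoundCodes n r K)
    (X : PointState n r L) (e : Roles n r) (j : Fin r) (a : Fin (n - 2 * r)) :
    repairRound C X e (e (Sum.inr j)) a =
      ∑ h, ∑ b, rowCoeff n C.mix (a, j) h b • codedSymbol C X e h b := by
  simp only [repairRound, Equiv.symm_apply_apply]
  rw [Fintype.sum_sum_type, Fintype.sum_sum_type]
  congr 1
  · rw [Finset.sum_comm]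
    refine Finset.sum_congr rfl fun b _ => ?_
    rw [Finset.sum_eq_single ⟨(a + b : ℕ) % (n - 2 * r), Nat.mod_lt _ a.pos⟩]
    · simp [rowCoeff, receivedMatrix]
    · intro h _ hne
      rw [rowCoeff, if_neg, zero_smul]
      exact fun heq => hne (Fin.ext heq.symm)
    · simp
  · rw [Finset.sum_comm]
    refine Finset.sum_congr rfl fun b _ => ?_
    rw [Finset.sum_eq_single ⟨(a + b : ℕ) % r, Nat.mod_lt _ b.pos⟩]
    · simp [rowCoeff, receivedMatrix]
    · intro h _ hne
      rw [rowCoeff, if_neg, zero_smul]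
      exact fun heq => hne (Fin.ext heq.symm)
    · simp

theorem add_mod_injective {N : ℕ} (a : ℕ) {c c' : ℕ} (hc : c < N) (hc' : c' < N)
    (h : (a + c) % N = (a + c') % N) : c = c' :=
  Nat.ModEq.eq_of_lt_of_lt (Nat.ModEq.add_left_cancel' a h) hc hc'

theorem sum_cyclic_shift {N : ℕ} (a : ℕ) (f : Fin N → ℕ) :
    ∑ c : Fin N, f ⟨(a + c) % N, Nat.mod_lt _ c.pos⟩ = ∑ h, f h := by
  refine Function.Bijective.sum_comp
    (e := fun c : Fin N => (⟨(a + c) % N, Nat.mod_lt _ c.pos⟩ : Fin N))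
    (Finite.injective_iff_bijective.1 fun c c' h => ?_) f
  exact Fin.ext (add_mod_injective a c.2 c'.2 (congrArg Fin.val h))

/-- Rows of the received matrix, by class modulo `r` and block. -/
def rowEquiv (hν : n - 2 * r = ν * r) : Fin r × Fin ν ≃ Fin (n - 2 * r) :=
  ((Equiv.prodComm _ _).trans finProdFinEquiv).trans (finCongr hν.symm)

theorem rowEquiv_val (hν : n - 2 * r = ν * r) (p : Fin r × Fin ν) :
    (rowEquiv hν p : ℕ) = p.1 + r * p.2 := by
  simp [rowEquiv, finProdFinEquiv]

/-- With generic mixing matrices, the points of `q` newcomers that are independent in the symbols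
of the helpers outside `T` are numerous enough for the cut function to be passed on. -/
theorem exists_independent_rows (hr : 0 < r) (hν : n - 2 * r = ν * r)
    {M : ℕ → Matrix (Fin r ⊕ Fin r) (Fin r) K} (hM : MixGeneric ν M) (Q : Finset (Fin r))
    (T : Finset (Fin (n - 2 * r) ⊕ Fin r)) :
    ∃ I : Finset (Fin (n - 2 * r) × Fin r), (∀ p ∈ I, p.2 ∈ Q) ∧
      cutValue ν r (T.card + Q.card) ≤ cutValue ν r T.card + I.card ∧
      ∀ μ : Fin (n - 2 * r) × Fin r → K, (∀ p ∉ I, μ p = 0) →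
        (∀ h ∉ T, ∀ b, ∑ p, μ p * rowCoeff n M p h b = 0) → μ = 0 := by
  classical
  let X : Fin r → Fin ν → Finset (Fin r) := fun a β =>
    {b | Sum.inl ⟨((rowEquiv hν (a, β) + b : ℕ)) % (n - 2 * r),
      Nat.mod_lt _ (rowEquiv hν (a, β)).pos⟩ ∉ T}
  let Y : Fin r → Finset (Fin r) := fun a => {b | Sum.inr ⟨(a + b : ℕ) % r, Nat.mod_lt _ hr⟩ ∉ T}
  choose I hIQ hI hli using fun a => hM Q (X a) (Y a)
  -- each class contains every symbol of the first helpers once, and so for the last helpers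
  have hX : ∀ a, ∑ β, (X a β).card = ∑ h : Fin (n - 2 * r), if Sum.inl h ∉ T then 1 else 0 := by
    intro a
    rw [← sum_cyclic_shift (a : ℕ) (fun h => if Sum.inl h ∉ T then 1 else 0),
      ← (((Equiv.prodComm _ _).trans (rowEquiv hν))).sum_comp, Fintype.sum_prod_type]
    refine Finset.sum_congr rfl fun β _ => ?_
    rw [Finset.card_filter]
    refine Finset.sum_congr rfl fun b _ => ?_
    have : (rowEquiv hν (a, β) + b : ℕ) = a + rowEquiv hν (b, β) := by
      rw [rowEquiv_val, rowEquiv_val]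
      ring
    simp only [this, Equiv.trans_apply, Equiv.prodComm_apply, Prod.swap_prod_mk]
    exact if_congr Iff.rfl rfl rfl
  have hY : ∀ a, (Y a).card = ∑ h : Fin r, if Sum.inr h ∉ T then 1 else 0 := by
    intro a
    rw [← sum_cyclic_shift (a : ℕ) (fun h => if Sum.inr h ∉ T then 1 else 0), Finset.card_filter]
  have hT : ∀ a, ∑ β, (X a β).card + (Y a).card + T.card = (ν + 1) * r := by
    intro a
    have h1 : ∑ h, (if h ∉ T then 1 else 0) + T.card = (ν + 1) * r := by
      rw [← Finset.card_filter, Finset.filter_notMem_eq_sdiff, ← Finset.compl_eq_univ_sdiff,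
        Finset.card_compl_add_card, Fintype.card_sum, Fintype.card_fin, Fintype.card_fin, hν]
      ring
    rw [hX, hY, ← h1, Fintype.sum_sum_type]
  let E : (Σ _ : Fin r, Fin ν × Fin r) ≃ Fin (n - 2 * r) × Fin r :=
    ((Equiv.sigmaEquivProd _ _).trans (Equiv.prodAssoc _ _ _).symm).trans
      (Equiv.prodCongr (rowEquiv hν) (Equiv.refl _))
  refine ⟨(Finset.univ.sigma I).map E.toEmbedding, ?_, ?_, fun μ hμ hl => ?_⟩
  · intro p hp
    obtain ⟨⟨a, β, j⟩, h, rfl⟩ := Finset.mem_map.1 hp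
    exact hIQ a _ (Finset.mem_sigma.1 h).2
  · rw [Finset.card_map, Finset.card_sigma]
    have h1 : ∀ a ∈ (Finset.univ : Finset (Fin r)),
        ∑ i ∈ Finset.range (T.card + Q.card), min ν (ν + 1 - i / r) ≤
        ∑ i ∈ Finset.range T.card, min ν (ν + 1 - i / r) + (I a).card := fun a _ =>
      (cut_slope_sum_le hr (by simpa using Finset.card_le_univ Q) (fun β => (X a β).card)
        (Y a).card (fun β => by simpa using Finset.card_le_univ (X a β))
        (by simpa using Finset.card_le_univ (Y a)) (hT a)).trans
        (Nat.add_le_add_left (hI a) _)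
    have h2 := Finset.sum_le_sum h1
    rw [Finset.sum_add_distrib, Finset.sum_const, Finset.sum_const, Finset.card_univ,
      Fintype.card_fin, smul_eq_mul, smul_eq_mul] at h2
    exact h2
  · have hdiv : ∀ a β, (rowEquiv hν (a, β) : ℕ) / r = β := by
      intro a β
      rw [rowEquiv_val, Nat.add_mul_div_left _ _ hr, Nat.div_eq_of_lt a.2, zero_add]
    have hmod : ∀ a β (b : Fin r), (rowEquiv hν (a, β) + b : ℕ) % r = (a + b : ℕ) % r := by
      intro a β b
      rw [rowEquiv_val, add_right_comm, Nat.add_mul_mod_self_left]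
    have h0 : ∀ a, (fun p : Fin ν × Fin r => μ (rowEquiv hν (a, p.1), p.2)) = 0 := by
      intro a
      refine hli a _ (fun p hp => hμ _ fun hp' => ?_) (fun β b hb => ?_) (fun b hb => ?_)
      · obtain ⟨⟨a', β, j⟩, h, h'⟩ := Finset.mem_map.1 hp'
        have h2 : (⟨a', β, j⟩ : Σ _ : Fin r, Fin ν × Fin r) = ⟨a, p⟩ := E.injective h'
        rw [h2] at h
        exact hp (Finset.mem_sigma.1 h).2
      · have h1 := hl _ (Finset.mem_filter.1 hb).2 b
        rw [Fintype.sum_prod_type, Finset.sum_eq_single (rowEquiv hν (a, β))] at h1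
        · simpa [rowCoeff, hdiv] using h1
        · intro c _ hne
          refine Finset.sum_eq_zero fun j _ => ?_
          rw [rowCoeff, if_neg, mul_zero]
          intro h
          refine hne (Fin.ext (add_mod_injective b c.2 (rowEquiv hν (a, β)).2 ?_))
          rw [add_comm (b : ℕ), add_comm (b : ℕ)]
          exact h
        · simp
      · have h1 := hl _ (Finset.mem_filter.1 hb).2 b
        rw [Fintype.sum_prod_type, ← (rowEquiv hν).sum_comp, Fintype.sum_prod_type,
          Finset.sum_eq_single a] at h1
        · rw [Fintype.sum_prod_type]
          simpa [rowCoeff, hdiv, hmod] using h1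
        · intro c _ hne
          refine Finset.sum_eq_zero fun β _ => Finset.sum_eq_zero fun j _ => ?_
          rw [rowCoeff, if_neg, mul_zero]
          intro h
          refine hne (Fin.ext (add_mod_injective b c.2 a.2 ?_))
          rw [hmod] at h
          rw [add_comm (b : ℕ), add_comm (b : ℕ)]
          exact h
        · simp
    funext ⟨c, j⟩
    obtain ⟨⟨a, β⟩, rfl⟩ := (rowEquiv hν).surjective c
    exact congrFun (h0 a) (β, j)

end Rows

/-! ### The choice of the codes of a round -/

/-- The form of `HoldsOffHypersurface.le_finrank_span` for linear maps. -/
theorem HoldsOffHypersurface.le_finrank_span_linearMap {ι K κ V : Type*} [Field K] [Fintype ι]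
    [Finite κ] [AddCommGroup V] [Module K V] {D : ℕ} (c : κ → V) (φ : κ → (ι → K) →ₗ[K] V)
    (x₀ : ι → K) (h : D ≤ Module.finrank K (Submodule.span K (Set.range fun i => c i + φ i x₀))) :
    HoldsOffHypersurface D (fun x : ι → K =>
      D ≤ Module.finrank K (Submodule.span K (Set.range fun i => c i + φ i x))) := by
  classical
  have key : ∀ (i : κ) (x : ι → K), φ i x = ∑ e, x e • φ i (Pi.single e 1) := fun i x => by
    conv_lhs => rw [LinearMap.pi_apply_eq_sum_univ (φ i) x]
    refine Finset.sum_congr rfl fun e _ => ?_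
    congr 2
    ext e'
    simp [Pi.single_apply, eq_comm]
  have key' : ∀ x, (fun i => c i + φ i x) = fun i => c i + ∑ e, x e • φ i (Pi.single e 1) :=
    fun x => funext fun i => by rw [← key]
  rw [key'] at h
  refine (HoldsOffHypersurface.le_finrank_span c (fun i e => φ i (Pi.single e 1)) x₀ h).mono le_rfl
    fun x hx => ?_
  rw [key']
  exact hx

/-- A generic matrix is MDS: the `s c` are distinct columns, and `g c i` is the parameter in
position `(c, i)`. The witness for `s` has the identity matrix in these columns. -/
theorem holdsOffHypersurface_enc_mds {K κ ι ι' : Type*} [Field K] [Fintype κ] [Fintype ι']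
    [DecidableEq κ] [DecidableEq ι'] (g : κ → ι → ι') (hg : ∀ c, Function.Injective (g c))
    (hg' : ∀ c c' i j, g c i = g c' j → c = c') (s : κ → ι) (hs : Function.Injective s) :
    HoldsOffHypersurface (Fintype.card κ) (fun x : ι' → K =>
      LinearIndependent K (fun c => (Matrix.of fun c' i => x (g c' i)).col (s c))) := by
  classical
  have key : ∀ (x : ι' → K) (c : κ), (Matrix.of fun c' i => x (g c' i)).col (s c) =
      (0 : κ → K) + ∑ e, x e • (fun c' => if e = g c' (s c) then (1 : K) else 0) := by
    intro x c
    funext c'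
    simp [Finset.sum_apply]
  have hli : LinearIndependent K (fun c => (Matrix.of fun c' i =>
      (fun e => if e = g c' (s c') then (1 : K) else 0) (g c' i) : Matrix κ ι K).col (s c)) := by
    have := (Pi.basisFun K κ).linearIndependent
    convert this using 1
    funext c c'
    simp [Pi.single_apply, (hg _).eq_iff, hs.eq_iff, eq_comm]
  let x₀ : ι' → K := fun e => if ∃ c, e = g c (s c) then 1 else 0
  have hx₀ : ∀ c' i, x₀ (g c' i) = if g c' i = g c' (s c') then (1 : K) else 0 := by
    intro c' i
    simp only [x₀]
    refine if_congr ⟨?_, fun h => ⟨c', h⟩⟩ rfl rfl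
    rintro ⟨c, h⟩
    obtain rfl := hg' _ _ _ _ h
    exact h
  simp only [key]
  refine HoldsOffHypersurface.linearIndependent (fun _ => 0) _ x₀ ?_
  simp only [← key, hx₀]
  exact hli

section Round

variable {n r ν : ℕ} {K L : Type*} [Field K] [Field L] [Algebra K L]

/-- Every set of nodes stores at least as much as the cut function says. -/
def IsSpread (K : Type*) {L : Type*} [Field K] [Field L] [Algebra K L] (ν : ℕ)
    (X : PointState n r L) : Prop :=
  ∀ S : Finset (Fin n), cutValue ν r S.card ≤ Module.finrank K (storedSubspace K X S)

/-- Every set of helpers of a round stores at least as much as the cut function says. -/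
def HelpersSpread (K : Type*) {L : Type*} [Field K] [Field L] [Algebra K L] (ν : ℕ)
    (X : PointState n r L) (e : Roles n r) : Prop :=
  ∀ T : Finset (Fin (n - 2 * r) ⊕ Fin r), cutValue ν r T.card ≤
    Module.finrank K (⨆ h ∈ T, Submodule.span K (Set.range (X (e (Sum.inl h)))) : Submodule K L)

theorem IsSpread.helpersSpread {X : PointState n r L} (hX : IsSpread K ν X) (e : Roles n r) :
    HelpersSpread K ν X e := by
  classical
  intro T
  have := hX (T.image fun h => e (Sum.inl h))
  rwa [Finset.card_image_of_injective _ fun _ _ h => Sum.inl_injective (e.injective h),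
    storedSubspace, Finset.iSup_finset_image] at this

theorem storedSubspace_eq_span (X : PointState n r L) (S : Finset (Fin n)) :
    storedSubspace K X S =
      Submodule.span K (Set.range fun p : S × Fin (n - 2 * r) => X p.1 p.2) := by
  refine le_antisymm (iSup₂_le fun i hi => Submodule.span_mono ?_) (Submodule.span_le.2 ?_)
  · rintro _ ⟨a, rfl⟩
    exact ⟨(⟨i, hi⟩, a), rfl⟩
  · rintro _ ⟨⟨i, a⟩, rfl⟩
    exact Submodule.mem_iSup_of_mem i.1 (Submodule.mem_iSup_of_mem i.2
      (Submodule.subset_span ⟨a, rfl⟩))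

/-- The part of a point after a repair round that does not depend on the encoding matrices. -/
def keptPoint (X : PointState n r L) (e : Roles n r) (i : Fin n) (a : Fin (n - 2 * r)) : L :=
  match e.symm i with
  | Sum.inl _ => X i a
  | Sum.inr _ => 0

/-- The part of a point after a repair round that is linear in the entries `x` of the encoding
matrices; `x (i, s, j)` is the coefficient of the `s`-th point of node `i` in its coded symbol
for node `j`. -/
def repairedPoint (M : ℕ → Matrix (Fin r ⊕ Fin r) (Fin r) K) (X : PointState n r L)
    (e : Roles n r) (i : Fin n) (a : Fin (n - 2 * r)) :
    (Fin n × Fin (n - 2 * r) × Fin n → K) →ₗ[K] L :=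
  match e.symm i with
  | Sum.inl _ => 0
  | Sum.inr j => ∑ h, ∑ b, rowCoeff n M (a, j) h b • ∑ s,
      (LinearMap.proj (e (Sum.inl h), s, e (Sum.inr b)) :
        (Fin n × Fin (n - 2 * r) × Fin n → K) →ₗ[K] K).smulRight (X (e (Sum.inl h)) s)

theorem repairRound_eq (C : RoundCodes n r K) (X : PointState n r L) (e : Roles n r)
    (x : Fin n × Fin (n - 2 * r) × Fin n → K) (hx : ∀ i s j, C.enc i s j = x (i, s, j))
    (i : Fin n) (a : Fin (n - 2 * r)) :
    repairRound C X e i a = keptPoint X e i a + repairedPoint C.mix X e i a x := by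
  rcases h : e.symm i with h' | j
  · simp [repairRound, keptPoint, repairedPoint, h]
  · obtain rfl : i = e (Sum.inr j) := by rw [← h, Equiv.apply_symm_apply]
    rw [repairRound_newcomer]
    simp [keptPoint, repairedPoint, LinearMap.sum_apply, codedSymbol, hx]

/-- In a round whose helpers are spread, all sets of nodes store enough after the repair for
generic encoding matrices. -/
theorem holdsOffHypersurface_repair [Fintype K] [Finite L] (hr : 0 < r) (hν : n - 2 * r = ν * r)
    (hn : 2 * r ≤ n) (hK : n + 1 < Fintype.card K) {M : ℕ → Matrix (Fin r ⊕ Fin r) (Fin r) K}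
    (hM : MixGeneric ν M) (X : PointState n r L) (e : Roles n r) (hX : HelpersSpread K ν X e)
    (S : Finset (Fin n)) :
    HoldsOffHypersurface (cutValue ν r S.card) (fun x : Fin n × Fin (n - 2 * r) × Fin n → K =>
      cutValue ν r S.card ≤ Module.finrank K (Submodule.span K
        (Set.range fun p : S × Fin (n - 2 * r) =>
          keptPoint X e p.1 p.2 + repairedPoint M X e p.1 p.2 x))) := by
  classical
  have := Module.Finite.of_finite (R := K) (M := L)
  let P : Finset (Fin (n - 2 * r) ⊕ Fin r) := {h | e (Sum.inl h) ∈ S}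
  let Q : Finset (Fin r) := {j | e (Sum.inr j) ∈ S}
  let V : Fin (n - 2 * r) ⊕ Fin r → Submodule K L := fun h =>
    Submodule.span K (Set.range (X (e (Sum.inl h))))
  let A : Fin (n - 2 * r) × Fin r → Fin (n - 2 * r) ⊕ Fin r → Fin r → K := fun p =>
    if p.2 ∈ Q then rowCoeff n M p else 0
  have hS : S.card = P.card + Q.card := by
    have h1 : S.card = ∑ i, if i ∈ S then 1 else 0 := by
      rw [← Finset.card_filter, Finset.filter_univ_mem]
    rw [h1, ← e.sum_comp, Fintype.sum_sum_type, Finset.card_filter, Finset.card_filter]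
  obtain ⟨w, hw, T, hT, hrel⟩ := exists_generic_messages (K := K) (by
    rw [Fintype.card_sum, Fintype.card_fin, Fintype.card_fin]
    omega) V (⨆ h ∈ P, V h) A
  obtain ⟨I, hIQ, hI, hli⟩ := exists_independent_rows hr hν hM Q T
  set W := spanWith (⨆ h ∈ P, V h) A w with hW
  have hPT : P ⊆ T := fun h hh =>
    (hT h).2 ((le_iSup₂_of_le (f := fun h (_ : h ∈ P) => V h) h hh le_rfl).trans le_sup_left)
  have hdim := finrank_add_card_le (U := ⨆ h ∈ T, V h) (W := W)
    (iSup₂_le fun h hh => (hT h).1 hh) I (fun p => ∑ h, ∑ b, A p h b • w h b)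
    (fun p => Submodule.mem_sup_right (Submodule.subset_span ⟨p, rfl⟩))
    (fun μ hμ hmem => hli μ hμ fun h hh b => by
      rw [← hrel μ hmem h hh b]
      refine Finset.sum_congr rfl fun p _ => ?_
      by_cases hp : p ∈ I
      · simp [A, hIQ p hp]
      · simp [hμ p hp])
  have hw' : ∀ h b, ∃ y : Fin (n - 2 * r) → K, ∑ s, y s • X (e (Sum.inl h)) s = w h b := fun h b =>
    (Submodule.mem_span_range_iff_exists_fun K).1 (hw h b)
  choose y hy using hw'
  let x₀ : Fin n × Fin (n - 2 * r) × Fin n → K := fun q =>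
    match e.symm q.1, e.symm q.2.2 with
    | Sum.inl h, Sum.inr b => y h b q.2.1
    | _, _ => 0
  refine HoldsOffHypersurface.le_finrank_span_linearMap _ _ x₀ ?_
  have hWle : W ≤ Submodule.span K (Set.range fun p : S × Fin (n - 2 * r) =>
      keptPoint X e p.1 p.2 + repairedPoint M X e p.1 p.2 x₀) := by
    refine sup_le (iSup₂_le fun h hh => Submodule.span_le.2 ?_) (Submodule.span_le.2 ?_)
    · rintro _ ⟨s, rfl⟩
      refine Submodule.subset_span ⟨(⟨e (Sum.inl h), (Finset.mem_filter.1 hh).2⟩, s), ?_⟩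
      simp [keptPoint, repairedPoint]
    · rintro _ ⟨⟨a, j⟩, rfl⟩
      by_cases hj : j ∈ Q
      · refine Submodule.subset_span ⟨(⟨e (Sum.inr j), (Finset.mem_filter.1 hj).2⟩, a), ?_⟩
        simp only [keptPoint, repairedPoint, Equiv.symm_apply_apply, zero_add,
          LinearMap.sum_apply, LinearMap.smul_apply, LinearMap.smulRight_apply,
          LinearMap.proj_apply, x₀, A, hj, if_true, hy]
      · simp [A, hj]
  calc cutValue ν r S.card ≤ cutValue ν r (T.card + Q.card) :=
        cutValue_mono _ _ (hS.trans_le (Nat.add_le_add_right (Finset.card_le_card hPT) _))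
    _ ≤ cutValue ν r T.card + I.card := hI
    _ ≤ Module.finrank K (⨆ h ∈ T, V h : Submodule K L) + I.card :=
        Nat.add_le_add_right (hX T) _
    _ ≤ Module.finrank K W := hdim
    _ ≤ _ := Submodule.finrank_mono hWle

/-- Over a sufficiently large field, codes for a round can be chosen as a function of the stored
points so that every round with spread helpers leads to a spread state. -/
theorem exists_round_rule (hr : 0 < r) (hν : n - 2 * r = ν * r) (hν0 : 0 < ν) (hn : 2 * r ≤ n) :
    ∃ q₀ : ℕ, ∀ (K L : Type) [Field K] [Fintype K] [Field L] [Fintype L] [Algebra K L],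
      q₀ ≤ Fintype.card K → ∃ σ : PointState n r L → RoundCodes n r K,
        (r = 1 → ∀ X b, (σ X).mix b = (σ X).mix 0) ∧
        ∀ X e, HelpersSpread K ν X e → IsSpread K ν (repairRound (σ X) X e) := by
  classical
  obtain ⟨D, hD⟩ := exists_mixGeneric hr hν0
  let D' := Fintype.card (Roles n r × Finset (Fin n)) * (n * (r * ν)) +
    Fintype.card (Σ i : Fin n, Fin (n - 2 * r) ↪ {j : Fin n // j ≠ i}) * (n - 2 * r)
  refine ⟨max (D + 1) (max (n + 2) (D' + 1)), fun K L _ _ _ _ _ hK => ?_⟩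
  obtain ⟨M, hM1, hM2, hM3⟩ := hD K (by omega)
  suffices h : ∀ X : PointState n r L, ∃ C : RoundCodes n r K, C.mix = M ∧
      ∀ e, HelpersSpread K ν X e → IsSpread K ν (repairRound C X e) by
    choose σ hσ hσ' using h
    exact ⟨σ, fun h1 X b => by rw [hσ, hM1 h1], hσ'⟩
  intro X
  have g1 := HoldsOffHypersurface.forall_fintype (K := K) (D := n * (r * ν))
    (Φ := fun (q : Roles n r × Finset (Fin n)) x => HelpersSpread K ν X q.1 →
      cutValue ν r q.2.card ≤ Module.finrank K (Submodule.span K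
        (Set.range fun p : q.2 × Fin (n - 2 * r) =>
          keptPoint X q.1 p.1 p.2 + repairedPoint M X q.1 p.1 p.2 x))) (fun q => by
    by_cases hq : HelpersSpread K ν X q.1
    · refine (holdsOffHypersurface_repair hr hν hn (by omega) hM3 X q.1 hq q.2).mono ?_
        fun x hx _ => hx
      refine (cutValue_le _ _ _).trans (Nat.mul_le_mul_right _ ?_)
      simpa using Finset.card_le_univ q.2
    · exact HoldsOffHypersurface.of_forall fun x h => absurd h hq)
  have g2 := HoldsOffHypersurface.forall_fintype (K := K) (D := n - 2 * r)
    (Φ := fun (q : Σ i : Fin n, Fin (n - 2 * r) ↪ {j : Fin n // j ≠ i}) x =>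
      LinearIndependent K (fun c => (Matrix.of fun s (j : {j : Fin n // j ≠ q.1}) =>
        x (q.1, s, j.1)).col (q.2 c))) (fun q => by
    have := holdsOffHypersurface_enc_mds (K := K)
      (fun (s : Fin (n - 2 * r)) (j : {j : Fin n // j ≠ q.1}) => (q.1, s, j.1))
      (fun c j j' h => Subtype.ext (congrArg (fun p => p.2.2) h))
      (fun c c' j j' h => congrArg (fun p => p.2.1) h) q.2 q.2.injective
    exact this.mono (by simp) fun x hx => hx)
  obtain ⟨x, hx1, hx2⟩ := (g1.and g2).exists_point (by omega)
  let C : RoundCodes n r K :=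
    { enc := fun i => Matrix.of fun s j => x (i, s, j.1)
      enc_mds := fun i s hs => hx2 ⟨i, ⟨s, hs⟩⟩
      mix := M
      mix_mds := hM2 }
  refine ⟨C, rfl, fun e he S => ?_⟩
  rw [storedSubspace_eq_span]
  have heq : (fun p : S × Fin (n - 2 * r) => repairRound C X e p.1 p.2) = fun p =>
      keptPoint X e p.1 p.2 + repairedPoint M X e p.1 p.2 x :=
    funext fun p => repairRound_eq C X e x (fun _ _ _ => rfl) p.1 p.2
  rw [heq]
  exact hx1 (e, S) he

end Round

/-! ### Reading the file -/

section Linearized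

variable {K L : Type*} [Field K] [Fintype K] [Field L] [Algebra K L]

/-- A linearized polynomial as a linear map over the small field. -/
noncomputable def linearizedMap (K : Type*) {L : Type*} [Field K] [Fintype K] [Field L]
    [Algebra K L] {P : ℕ} (a : Fin P → L) : L →ₗ[K] L :=
  ∑ i : Fin P, LinearMap.mulLeft K (a i) ∘ₗ
    ((FiniteField.frobeniusAlgHom K L) ^ (i : ℕ)).toLinearMap

theorem linearizedMap_apply {P : ℕ} (a : Fin P → L) (x : L) :
    linearizedMap K a x = linearizedEval (Fintype.card K) a x := by
  simp only [linearizedMap, linearizedEval, LinearMap.sum_apply, LinearMap.comp_apply,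
    LinearMap.mulLeft_apply, AlgHom.toLinearMap_apply]
  refine Finset.sum_congr rfl fun i _ => ?_
  rw [AlgHom.coe_pow, FiniteField.coe_frobeniusAlgHom, pow_iterate]

/-- The values of a linearized polynomial with `P` coefficients at points that span a subspace of
dimension at least `P` determine it: otherwise the difference of two such polynomials, of degree
less than `q ^ P`, would vanish on the `q ^ P` elements of a subspace. -/
theorem linearizedEval_injective [Fintype L] {P : ℕ} {κ : Type*} (v : κ → L)
    (h : P ≤ Module.finrank K (Submodule.span K (Set.range v))) :
    Function.Injective (fun (a : Fin P → L) (p : κ) =>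
      linearizedEval (Fintype.card K) a (v p)) := by
  classical
  intro a a' haa
  set q := Fintype.card K with hq
  have hq1 : 1 < q := Fintype.one_lt_card
  let φ : L →ₗ[K] L := linearizedMap K a - linearizedMap K a'
  have hφ : Submodule.span K (Set.range v) ≤ LinearMap.ker φ := by
    refine Submodule.span_le.2 ?_
    rintro _ ⟨p, rfl⟩
    simp only [SetLike.mem_coe, LinearMap.mem_ker, φ, LinearMap.sub_apply, linearizedMap_apply]
    exact sub_eq_zero.2 (congrFun haa p)
  let f : Polynomial L := ∑ i : Fin P, Polynomial.C (a i - a' i) * Polynomial.X ^ q ^ (i : ℕ)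
  have hf : f = 0 := by
    refine Polynomial.eq_zero_of_natDegree_lt_card_of_eval_eq_zero' f
      (Finset.univ.filter (· ∈ LinearMap.ker φ)) (fun x hx => ?_) ?_
    · have hx' := (Finset.mem_filter.1 hx).2
      simp only [LinearMap.mem_ker, φ, LinearMap.sub_apply, linearizedMap_apply,
        linearizedEval, ← Finset.sum_sub_distrib, ← sub_mul] at hx'
      simpa [f, Polynomial.eval_finsetSum] using hx'
    · have h1 : f.natDegree < q ^ P := by
        rcases Nat.eq_zero_or_pos P with rfl | hP
        · simp [f]
        · refine (Polynomial.natDegree_sum_le_of_forall_le (n := q ^ (P - 1)) _ _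
            fun i _ => ?_).trans_lt (Nat.pow_lt_pow_right hq1 (by omega))
          exact (Polynomial.natDegree_C_mul_X_pow_le _ _).trans
            (Nat.pow_le_pow_right (by omega) (by omega))
      have h2 : (Finset.univ.filter (· ∈ LinearMap.ker φ)).card =
          q ^ Module.finrank K (LinearMap.ker φ) := by
        rw [← Fintype.card_subtype, hq, ← Module.card_eq_pow_finrank (K := K)]
      rw [h2]
      exact h1.trans_le (Nat.pow_le_pow_right (by omega)
        (h.trans (Submodule.finrank_mono hφ)))
  funext i
  have h3 := congrArg (fun g => Polynomial.coeff g (q ^ (i : ℕ))) hf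
  simp only [f, Polynomial.finsetSum_coeff, Polynomial.coeff_C_mul, Polynomial.coeff_X_pow,
    Polynomial.coeff_zero] at h3
  rw [Finset.sum_eq_single i] at h3
  · simpa [sub_eq_zero] using h3
  · intro j _ hne
    rw [if_neg, mul_zero]
    exact fun h => hne (Fin.ext (Nat.pow_right_injective hq1 h).symm)
  · simp

end Linearized

/-! ### Achievability -/

section Achievability

variable {n k r ν : ℕ} {K L : Type*} [Field K] [Field L] [Algebra K L]

/-- The helpers of a round are spread if their points are jointly independent, as they are for
the helpers of the first round. -/
theorem LinearIndependent.helpersSpread [FiniteDimensional K L] {X : PointState n r L}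
    {e : Roles n r} (hν : n - 2 * r = ν * r)
    (h : LinearIndependent K (fun p : (Fin (n - 2 * r) ⊕ Fin r) × Fin (n - 2 * r) =>
      X (e (Sum.inl p.1)) p.2)) : HelpersSpread K ν X e := by
  classical
  intro T
  have h1 := finrank_span_eq_card (h.comp (fun p : T × Fin (n - 2 * r) => ((p.1 : _), p.2))
    (fun p p' hp => by
      simp only [Prod.mk.injEq] at hp
      exact Prod.ext (Subtype.ext hp.1) hp.2))
  rw [Fintype.card_prod, Fintype.card_coe, Fintype.card_fin] at h1
  refine (cutValue_le _ _ _).trans ?_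
  rw [mul_comm r, ← hν, ← h1]
  refine Submodule.finrank_mono (Submodule.span_le.2 ?_)
  rintro _ ⟨⟨t, a⟩, rfl⟩
  exact Submodule.mem_iSup_of_mem t.1 (Submodule.mem_iSup_of_mem t.2
    (Submodule.subset_span ⟨a, rfl⟩))

/-- Any `r` nodes can be the newcomers of a round. -/
theorem exists_roles (hn : 2 * r ≤ n) (R : Finset (Fin n)) (hR : R.card = r) :
    ∃ e : Roles n r, (∀ j, e (Sum.inr j) ∈ R) ∧ ∀ h, e (Sum.inl h) ∉ R := by
  classical
  let e1 : Fin (n - 2 * r) ⊕ Fin r ≃ {i // i ∉ R} := Fintype.equivOfCardEq (by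
    rw [Fintype.card_sum, Fintype.card_fin, Fintype.card_fin, Fintype.card_subtype_compl,
      Fintype.card_fin, Fintype.card_coe, hR]
    omega)
  let e2 : Fin r ≃ {i // i ∈ R} := Fintype.equivOfCardEq (by simp [hR])
  refine ⟨(Equiv.sumCongr e1 e2).trans ((Equiv.sumComm _ _).trans (Equiv.sumCompl (· ∈ R))),
    fun j => ?_, fun h => ?_⟩
  · simp
  · simpa using (e1 h).2

theorem exists_spread_state [FiniteDimensional K L] (hn : 2 * r ≤ n) (hν : n - 2 * r = ν * r)
    (hL : (n - r) * (n - 2 * r) ≤ Module.finrank K L) {σ : PointState n r L → RoundCodes n r K}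
    (hσ : ∀ X e, HelpersSpread K ν X e → IsSpread K ν (repairRound (σ X) X e)) :
    ∃ X : PointState n r L, IsSpread K ν X := by
  obtain ⟨R, -, hR⟩ := Finset.exists_subset_card_eq (s := (Finset.univ : Finset (Fin n))) (n := r)
    (by rw [Finset.card_univ, Fintype.card_fin]; omega)
  obtain ⟨e, -⟩ := exists_roles hn R hR
  obtain ⟨v, hv⟩ := (exists_linearIndependent_of_le_finrank
    (R := K) (M := L) (n := Fintype.card ((Fin (n - 2 * r) ⊕ Fin r) × Fin (n - 2 * r))) (by
      rw [Fintype.card_prod, Fintype.card_sum, Fintype.card_fin, Fintype.card_fin]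
      refine le_trans (Nat.mul_le_mul_right _ ?_) hL
      omega))
  let v' := v ∘ Fintype.equivFin ((Fin (n - 2 * r) ⊕ Fin r) × Fin (n - 2 * r))
  have hv' : LinearIndependent K v' := hv.comp _ (Equiv.injective _)
  refine ⟨_, hσ (fun i a => (e.symm i).elim (fun h => v' (h, a)) fun _ => 0) e
    (LinearIndependent.helpersSpread hν ?_)⟩
  simpa using hv'

/-- The contents of the nodes as functions of the file. -/
def contents (K : Type*) {L : Type*} [Fintype K] [Field L] (B : ℕ) (X : PointState n r L) :
    Fin n → (Fin B → L) → (Fin (n - 2 * r) → L) :=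
  fun i f s => linearizedEval (Fintype.card K) f (X i s)

/-- The contents of the nodes in all spread states form a functional repair code. -/
theorem isFunctionalRepairCode_contents {K L : Type} [Field K] [Field L] [Algebra K L]
    [Fintype K] [Fintype L] (hn : 2 * r ≤ n)
    {σ : PointState n r L → RoundCodes n r K}
    (hσ : ∀ X e, HelpersSpread K ν X e → IsSpread K ν (repairRound (σ X) X e))
    (hne : ∃ X : PointState n r L, IsSpread K ν X) :
    IsFunctionalRepairCode n k (n - r) r (Fin r → L)
      {E | ∃ X : PointState n r L, IsSpread K ν X ∧ E = contents K (cutValue ν r k) X} := by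
  classical
  refine ⟨hne.imp' _ fun X hX => ⟨X, hX, rfl⟩, ?_⟩
  rintro _ ⟨X, hX, rfl⟩
  refine ⟨fun S hS f f' hff => ?_, fun R H hR hH hRH => ?_⟩
  · have h1 := hX S
    rw [hS, storedSubspace_eq_span] at h1
    exact linearizedEval_injective _ h1 (funext fun p => congrFun (congrFun hff p.1) p.2)
  · obtain ⟨e, heR, heH⟩ := exists_roles hn R hR
    have hHR : Rᶜ = H := by
      refine (Finset.eq_of_subset_of_card_le (Finset.subset_compl_iff_disjoint_left.2 hRH) ?_).symm
      rw [Finset.card_compl, Fintype.card_fin, hR, hH]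
    have hmem : ∀ h, e (Sum.inl h) ∈ H := fun h => hHR ▸ Finset.mem_compl.2 (heH h)
    refine ⟨fun h c b => ∑ s, (σ X).enc h s ⟨e (Sum.inr b), fun h' =>
        Finset.disjoint_left.1 hRH (heR b) (h' ▸ h.2)⟩ • c s,
      fun i w a => (e.symm i).elim (fun _ => 0) fun j =>
        ∑ h, ∑ b, rowCoeff n (σ X).mix (a, j) h b • w ⟨e (Sum.inl h), hmem h⟩ b,
      repairRound (σ X) X e, hσ X e (hX.helpersSpread e), ?_⟩
    funext i f a
    simp only [contents]
    obtain ⟨x, rfl⟩ := e.surjective i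
    rcases x with h | j
    · rw [if_neg (heH h)]
      simp [repairRound, contents]
    · rw [if_pos (heR j), repairRound_newcomer, ← linearizedMap_apply (K := K)]
      simp only [Equiv.symm_apply_apply, Sum.elim_inr, map_sum, map_smul, codedSymbol,
        linearizedMap_apply]

theorem IsFunctionalRepairCode.congr {d : ℕ} {F F' A A' Q Q' : Type} {𝒢 : Set (Fin n → F → A)}
    (h : IsFunctionalRepairCode n k d r Q 𝒢) (eF : F' ≃ F) (eA : A ≃ A') (eQ : Q ≃ Q') :
    IsFunctionalRepairCode n k d r Q' ((fun E i f => eA (E i (eF f))) '' 𝒢) := by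
  refine ⟨h.1.image _, ?_⟩
  rintro _ ⟨E, hE, rfl⟩
  obtain ⟨h1, h2⟩ := h.2 E hE
  refine ⟨fun S hS f f' hff => eF.injective (h1 S hS (funext fun i =>
    eA.injective (congrFun hff i))), fun R H hR hH hRH => ?_⟩
  obtain ⟨μ, ρ, hμ⟩ := h2 R H hR hH hRH
  refine ⟨fun h c => eQ (μ h (eA.symm c)), fun i w => eA (ρ i fun h => eQ.symm (w h)), _, hμ, ?_⟩
  funext i f
  by_cases hi : i ∈ R <;> simp [hi]

/-- The operating point of the code: per node `n - 2r` elements of `L` are stored, and each of the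
`n - r` helpers broadcasts `r` elements of `L`. -/
theorem achievable_cutValue {K L : Type} [Field K] [Field L] [Algebra K L]
    [Fintype K] [Fintype L] (hn : 2 * r ≤ n)
    {σ : PointState n r L → RoundCodes n r K}
    (hσ : ∀ X e, HelpersSpread K ν X e → IsSpread K ν (repairRound (σ X) X e))
    (hne : ∃ X : PointState n r L, IsSpread K ν X) :
    Achievable n k (n - r) r (cutValue ν r k * Real.logb 2 (Fintype.card L))
      (((n - 2 * r : ℕ) : ℝ) * Real.logb 2 (Fintype.card L))
      (((n - r : ℕ) : ℝ) * (r * Real.logb 2 (Fintype.card L))) := by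
  classical
  have hpow : ∀ m : ℕ, Fintype.card (Fin m → L) = Fintype.card L ^ m := fun m => by simp
  refine ⟨Fintype.card L ^ cutValue ν r k, Fintype.card L ^ (n - 2 * r), Fintype.card L ^ r, _,
    Nat.pow_pos Fintype.card_pos, ?_, ?_, ?_,
    (isFunctionalRepairCode_contents (k := k) hn hσ hne).congr
      (Fintype.equivFinOfCardEq (hpow _)).symm (Fintype.equivFinOfCardEq (hpow _))
      (Fintype.equivFinOfCardEq (hpow _))⟩
  all_goals simp [Real.logb_pow]

end Achievability

/-! ### The cut-set bound -/

section CutSet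

theorem ncard_range_le_mul {F Z Z₁ Z₂ : Type*} [Finite F] [Fintype Z₂] (g : F → Z) (g₁ : F → Z₁)
    (g₂ : F → Z₂) (h : ∀ f f', g₁ f = g₁ f' → g₂ f = g₂ f' → g f = g f') :
    (Set.range g).ncard ≤ (Set.range g₁).ncard * Fintype.card Z₂ := by
  have : Finite (Set.range g₁) := Set.finite_range g₁
  rw [← Nat.card_coe_set_eq, ← Nat.card_coe_set_eq, ← Nat.card_eq_fintype_card (α := Z₂),
    ← Nat.card_prod]
  refine Nat.card_le_card_of_injective
    (fun z : Set.range g => ((⟨g₁ z.2.choose, z.2.choose, rfl⟩ : Set.range g₁), g₂ z.2.choose))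
    fun z z' hz => ?_
  have hz1 := congrArg (fun p => (p.1 : Z₁)) hz
  have hz2 := congrArg Prod.snd hz
  refine Subtype.ext ?_
  rw [← z.2.choose_spec, ← z'.2.choose_spec]
  exact h _ _ hz1 hz2

variable {n k r κ : ℕ}

/-- The first `s` nodes. -/
def firstNodes (n s : ℕ) : Finset (Fin n) := {j | (j : ℕ) < s}

theorem card_firstNodes {s : ℕ} (hs : s ≤ n) : (firstNodes n s).card = s := by
  rw [firstNodes, Fin.card_filter_val_lt, min_eq_right hs]

theorem card_firstNodes_sdiff {s t : ℕ} (hst : s ≤ t) (ht : t ≤ n) :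
    (firstNodes n t \ firstNodes n s).card = t - s := by
  rw [Finset.card_sdiff_of_subset, card_firstNodes ht, card_firstNodes (hst.trans ht)]
  intro j hj
  simp only [firstNodes, Finset.mem_filter, Finset.mem_univ, true_and] at hj ⊢
  omega

/-- The cut-set bound: when the groups of `r` nodes fail one after the other, the `i`-th group
adds at most what its nodes can store, and at most what the helpers outside the previous groups
send. -/
theorem IsFunctionalRepairCode.card_le {F A Q : Type} [Fintype F] [Fintype A] [Fintype Q]
    {𝒢 : Set (Fin n → F → A)} (hk : k = κ * r) (hkd : k ≤ n - r) (hrn : r ≤ n)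
    (h : IsFunctionalRepairCode n k (n - r) r Q 𝒢) :
    Fintype.card F ≤ ∏ i ∈ Finset.range κ,
      min (Fintype.card A ^ r) (Fintype.card Q ^ (n - r - i * r)) := by
  classical
  have key : ∀ i ≤ κ, ∃ E ∈ 𝒢, (Set.range fun (f : F) (j : firstNodes n (i * r)) => E j f).ncard ≤
      ∏ i ∈ Finset.range i, min (Fintype.card A ^ r) (Fintype.card Q ^ (n - r - i * r)) := by
    intro i
    induction i with
    | zero =>
      intro _
      obtain ⟨E, hE⟩ := h.1
      refine ⟨E, hE, ?_⟩
      have : IsEmpty (firstNodes n (0 * r)) := ⟨fun j => by simpa [firstNodes] using j.2⟩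
      simpa using Set.ncard_le_one_of_subsingleton
        (Set.range fun (f : F) (j : firstNodes n (0 * r)) => E j f)
    | succ i ih =>
      intro hi
      obtain ⟨E, hE, hcard⟩ := ih (by omega)
      have hir : (i + 1) * r ≤ n - r := (Nat.mul_le_mul_right r hi).trans (hk ▸ hkd)
      have hsucc : (i + 1) * r = i * r + r := by ring
      set R := firstNodes n ((i + 1) * r) \ firstNodes n (i * r) with hR
      have hRc : R.card = r := by
        rw [hR, card_firstNodes_sdiff (by omega) (by omega)]
        omega
      obtain ⟨μ, ρ, hμ⟩ := (h.2 E hE).2 R Rᶜ hRc (by rw [Finset.card_compl, Fintype.card_fin, hRc])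
        disjoint_compl_right
      refine ⟨_, hμ, ?_⟩
      rw [Finset.prod_range_succ]
      refine le_trans ?_ (Nat.mul_le_mul_right _ hcard)
      have hsub : ∀ j : Fin n, j ∈ firstNodes n ((i + 1) * r) → j ∉ R →
          j ∈ firstNodes n (i * r) := by
        intro j hj hjR
        by_contra hj'
        exact hjR (Finset.mem_sdiff.2 ⟨hj, hj'⟩)
      rw [← Nat.mul_min_mul_left]
      refine le_min ?_ ?_
      · have h1 := ncard_range_le_mul
          (fun (f : F) (j : firstNodes n ((i + 1) * r)) =>
            if (j : Fin n) ∈ R then ρ j (fun h => μ h (E h f)) else E j f)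
          (fun (f : F) (j : firstNodes n (i * r)) => E j f)
          (fun (f : F) (j : R) => ρ j (fun h => μ h (E h f))) (by
            intro f f' h1 h2
            funext j
            by_cases hj : (j : Fin n) ∈ R
            · simpa [hj] using congrFun h2 ⟨j, hj⟩
            · simpa [hj] using congrFun h1 ⟨j, hsub j j.2 hj⟩)
        rwa [Fintype.card_fun, Fintype.card_coe, hRc] at h1
      · have h1 := ncard_range_le_mul
          (fun (f : F) (j : firstNodes n ((i + 1) * r)) =>
            if (j : Fin n) ∈ R then ρ j (fun h => μ h (E h f)) else E j f)
          (fun (f : F) (j : firstNodes n (i * r)) => E j f)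
          (fun (f : F) (j : ((firstNodes n ((i + 1) * r))ᶜ : Finset (Fin n))) =>
            μ ⟨j, by
              have := j.2
              simp only [hR, Finset.mem_compl, Finset.mem_sdiff] at this ⊢
              tauto⟩ (E j f)) (by
            intro f f' h1 h2
            funext j
            by_cases hj : (j : Fin n) ∈ R
            · simp only [hj, if_true]
              congr 1
              funext x
              by_cases hx : (x : Fin n) ∈ firstNodes n (i * r)
              · rw [congrFun h1 ⟨x, hx⟩]
              · exact congrFun h2 ⟨x, Finset.mem_compl.2 fun hx' =>
                  hx (hsub x hx' (Finset.mem_compl.1 x.2))⟩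
            · simpa [hj] using congrFun h1 ⟨j, hsub j j.2 hj⟩)
        rw [Fintype.card_fun, Fintype.card_coe, Finset.card_compl, Fintype.card_fin,
          card_firstNodes (by omega)] at h1
        rwa [show n - r - i * r = n - (i + 1) * r by omega]
  obtain ⟨E, hE, hcard⟩ := key κ le_rfl
  refine le_trans (le_of_eq ?_) hcard
  have hinj := (h.2 E hE).1 (firstNodes n (κ * r)) (by rw [card_firstNodes (by omega), hk])
  rw [← Set.image_univ, Set.ncard_image_of_injective _ hinj, Set.ncard_univ,
    Nat.card_eq_fintype_card]

/-- The cut-set bound for achievable pairs. -/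
theorem Achievable.le_sum_min {M α γ : ℝ} (hk : k = κ * r) (hkd : k ≤ n - r) (hr : 0 < r)
    (hrn : r < n) (h : Achievable n k (n - r) r M α γ) :
    M ≤ ∑ i ∈ Finset.range κ,
      min (r * α) (((n - r - i * r : ℕ) : ℝ) * (γ / ((n - r : ℕ) : ℝ))) := by
  obtain ⟨N, a, b, 𝒢, hN, rfl, ha, hb, h𝒢⟩ := h
  have hcard := h𝒢.card_le hk hkd hrn.le
  simp only [Fintype.card_fin] at hcard
  have hd : (0 : ℝ) < ((n - r : ℕ) : ℝ) := by exact_mod_cast Nat.sub_pos_of_lt hrn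
  have hpos : ∀ i ∈ Finset.range κ, 0 < min (a ^ r) (b ^ (n - r - i * r)) := by
    intro i hi
    rw [Nat.pos_iff_ne_zero]
    intro h0
    rw [Finset.prod_eq_zero hi h0] at hcard
    omega
  have hlog : Real.logb 2 N ≤ ∑ i ∈ Finset.range κ,
      Real.logb 2 ((min (a ^ r) (b ^ (n - r - i * r)) : ℕ) : ℝ) := by
    rw [← Real.logb_prod _ _ (fun i hi => by exact_mod_cast (hpos i hi).ne'), ← Nat.cast_prod]
    exact Real.logb_le_logb_of_le one_lt_two (by exact_mod_cast hN) (by exact_mod_cast hcard)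
  refine hlog.trans (Finset.sum_le_sum fun i hi => le_min ?_ ?_)
  · calc Real.logb 2 ((min (a ^ r) (b ^ (n - r - i * r)) : ℕ) : ℝ)
        ≤ Real.logb 2 ((a : ℝ) ^ r) := Real.logb_le_logb_of_le one_lt_two
          (by exact_mod_cast hpos i hi) (by exact_mod_cast min_le_left _ _)
      _ = r * Real.logb 2 a := Real.logb_pow _ _ _
      _ ≤ r * α := by gcongr
  · calc Real.logb 2 ((min (a ^ r) (b ^ (n - r - i * r)) : ℕ) : ℝ)
        ≤ Real.logb 2 ((b : ℝ) ^ (n - r - i * r)) := Real.logb_le_logb_of_le one_lt_two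
          (by exact_mod_cast hpos i hi) (by exact_mod_cast min_le_right _ _)
      _ = ((n - r - i * r : ℕ) : ℝ) * Real.logb 2 b := Real.logb_pow _ _ _
      _ ≤ _ := by
        gcongr
        rw [le_div_iff₀ hd]
        linarith

end CutSet

/-! ### The tradeoff -/

/-- A closed form of the cut function at `(κ + 1) r`: all groups of `r` nodes but the first one
are limited by what the helpers send. -/
theorem two_mul_cutValue {ν r : ℕ} (hr : 0 < r) : ∀ κ ≤ ν, 2 * (cutValue ν r ((κ + 1) * r) : ℤ) =
    r ^ 2 * ((κ + 1) * (2 * ν - κ) + 2 * κ) := by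
  intro κ
  induction κ with
  | zero =>
    intro _
    rw [cutValue_mul hr]
    have : min (r * ν) ((ν + 1) * r - 0 * r) = r * ν :=
      min_eq_left (by rw [zero_mul, Nat.sub_zero]; nlinarith)
    simp only [zero_add, Finset.sum_range_one, this]
    push_cast
    ring
  | succ κ ih =>
    intro hκ
    have h1 := ih (by omega)
    rw [cutValue_mul hr] at h1 ⊢
    have : min (r * ν) ((ν + 1) * r - (κ + 1) * r) = r * (ν - κ) := by
      rw [← Nat.sub_mul, Nat.add_sub_add_right, mul_comm (ν - κ)]
      exact min_eq_right (Nat.mul_le_mul_left _ (Nat.sub_le _ _))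
    rw [Finset.sum_range_succ, this]
    push_cast [Nat.cast_sub (by omega : κ ≤ ν)] at h1 ⊢
    linear_combination h1

theorem packetCount_eq_cutValue {n κ ν r : ℕ} (hr : 0 < r) (hκ : κ ≤ ν) (hn : n = (ν + 2) * r) :
    packetCount n ((κ + 1) * r) r = cutValue ν r ((κ + 1) * r) := by
  have h1 := two_mul_cutValue hr κ hκ
  obtain ⟨c, rfl⟩ := Nat.exists_eq_add_of_le hκ
  have h2 : 2 * cutValue (κ + c) r ((κ + 1) * r) =
      (κ + 1) * r * ((κ + 2 * c) * r) + 2 * (r * (κ * r)) := by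
    zify
    rw [h1]
    push_cast
    ring
  have h3 : (κ + 1) * r - r = κ * r := by rw [Nat.succ_mul, Nat.add_sub_cancel]
  have h4 : 2 * (n - 2 * r) - κ * r = (κ + 2 * c) * r := by
    have : n - 2 * r = (κ + c) * r := by rw [hn, ← Nat.sub_mul, Nat.add_sub_cancel]
    rw [this, Nat.sub_eq_iff_eq_add]
    · ring
    · nlinarith [Nat.zero_le (c * r), Nat.zero_le (κ * r)]
  rw [packetCount, h3, h4]
  omega

/-- A pair that meets the first two terms of the cut-set bound with equality cannot be improved. -/
theorem tradeoff_optimal {n k r κ ν : ℕ} (hr : 0 < r) (hn : n = (ν + 2) * r)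
    (hk : k = (κ + 2) * r) (hkd : k ≤ n - r) {ℓ α γ : ℝ} (hℓ : 0 < ℓ)
    (h : Achievable n k (n - r) r (cutValue ν r k * ℓ) α γ)
    (hα : α ≤ ((n - 2 * r : ℕ) : ℝ) * ℓ) (hγ : γ ≤ ((n - r : ℕ) : ℝ) * (r * ℓ)) :
    α = ((n - 2 * r : ℕ) : ℝ) * ℓ ∧ γ = ((n - r : ℕ) : ℝ) * (r * ℓ) := by
  have hm : n - 2 * r = r * ν := by rw [hn, ← Nat.sub_mul, Nat.add_sub_cancel, mul_comm]
  have hd : n - r = (ν + 1) * r := by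
    rw [hn, ← Nat.sub_one_mul]
    rfl
  have hd0 : (0 : ℝ) < ((n - r : ℕ) : ℝ) := by
    rw [hd]
    positivity
  have hrℓ : 0 < (r : ℝ) := by exact_mod_cast hr
  have hbound := h.le_sum_min hk hkd hr (by rw [hn]; nlinarith)
  have hγ' : γ / ((n - r : ℕ) : ℝ) ≤ r * ℓ := by
    rw [div_le_iff₀ hd0]
    linarith
  have hcut : (cutValue ν r k : ℝ) * ℓ = ∑ i ∈ Finset.range (κ + 2),
      min (r * (((n - 2 * r : ℕ) : ℝ) * ℓ)) (((n - r - i * r : ℕ) : ℝ) * (r * ℓ)) := by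
    rw [hk, cutValue_mul hr, Nat.cast_sum, Finset.sum_mul]
    refine Finset.sum_congr rfl fun i _ => ?_
    rw [hd, hm]
    push_cast
    rw [← mul_assoc (r : ℝ) (r * ν : ℝ) ℓ,
      mul_comm (r : ℝ) (r * ν : ℝ), mul_assoc (r * ν : ℝ), ← min_mul_of_nonneg _ _ (by positivity)]
    ring
  rw [hcut] at hbound
  have hterm : ∀ i ∈ Finset.range (κ + 2),
      min (r * α) (((n - r - i * r : ℕ) : ℝ) * (γ / ((n - r : ℕ) : ℝ))) ≤
      min (r * (((n - 2 * r : ℕ) : ℝ) * ℓ)) (((n - r - i * r : ℕ) : ℝ) * (r * ℓ)) := fun i _ =>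
    min_le_min (by gcongr) (by gcongr)
  refine ⟨?_, ?_⟩
  · -- the first group of nodes receives more than it can store
    by_contra hne
    refine absurd hbound (not_le.2 (Finset.sum_lt_sum hterm ⟨0, by simp, ?_⟩))
    refine (min_le_left _ _).trans_lt (lt_min ?_ ?_)
    · exact mul_lt_mul_of_pos_left (lt_of_le_of_ne hα hne) hrℓ
    · refine (mul_lt_mul_of_pos_left (lt_of_le_of_ne hα hne) hrℓ).trans_le ?_
      rw [hm, hd]
      simp only [zero_mul, Nat.sub_zero]
      push_cast
      nlinarith [mul_pos (mul_pos hrℓ hrℓ) hℓ]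
  · -- the second group receives exactly what it can store
    by_contra hne
    refine absurd hbound (not_le.2 (Finset.sum_lt_sum hterm ⟨1, by simp, ?_⟩))
    have h1 : γ / ((n - r : ℕ) : ℝ) < r * ℓ := by
      rw [div_lt_iff₀ hd0]
      linarith [lt_of_le_of_ne hγ hne]
    have h2 : n - r - 1 * r = r * ν := by
      rw [one_mul, Nat.sub_sub, ← two_mul, hm]
    have hν : 0 < ν := by
      rcases Nat.eq_zero_or_pos ν with rfl | h0
      · rw [hk, hd] at hkd
        nlinarith
      · exact h0
    have h3 : (0 : ℝ) < ((r * ν : ℕ) : ℝ) := by exact_mod_cast Nat.mul_pos hr hν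
    rw [h2, hm]
    refine (min_le_right _ _).trans_lt (lt_min ?_ ?_)
    · refine (mul_lt_mul_of_pos_left h1 h3).trans_le (le_of_eq (by ring))
    · exact mul_lt_mul_of_pos_left h1 h3

theorem IsSpread.linearIndependent {n r ν : ℕ} {K L : Type*} [Field K] [Field L] [Algebra K L]
    {X : PointState n r L} (hν : n - 2 * r = ν * r) (hX : IsSpread K ν X) (i : Fin n) :
    LinearIndependent K (X i) := by
  rw [linearIndependent_iff_card_le_finrank_span, Fintype.card_fin]
  have h := hX {i}
  rw [Finset.card_singleton, cutValue_one, mul_comm, ← hν] at h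
  have h1 : storedSubspace K X {i} = Submodule.span K (Set.range (X i)) := by
    simp [storedSubspace]
  rw [h1] at h
  exact h

/-- Spreading is an invariant of the repair rounds. -/
theorem isSpread_stateAfter {n r ν : ℕ} {K L : Type*} [Field K] [Field L] [Algebra K L]
    {σ : PointState n r L → RoundCodes n r K}
    (hσ : ∀ X e, HelpersSpread K ν X e → IsSpread K ν (repairRound (σ X) X e))
    {X₀ : PointState n r L} {e : ℕ → Roles n r} (h : HelpersSpread K ν X₀ (e 0)) (t : ℕ) :
    IsSpread K ν (stateAfter σ X₀ e (t + 1)) := by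
  induction t with
  | zero => exact hσ _ _ h
  | succ t ih => exact hσ _ _ (ih.helpersSpread _)

theorem theorem3 (n k r : ℕ) (hr : 0 < r) (hk : 0 < k) (hrk : r ∣ k) (hrn : r ∣ n)
    (hn : 2 * r < n) (hkd : k ≤ n - r) :
    ∃ q₀ : ℕ, ∀ (K L : Type) [Field K] [Fintype K] [Field L] [Fintype L] [Algebra K L],
      q₀ ≤ Fintype.card K → (n - r) * (n - 2 * r) ≤ Module.finrank K L →
      -- the construction: any `k` nodes span enough, in every round, whatever nodes fail
      (∃ σ : PointState n r L → RoundCodes n r K,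
        -- for `r = 1` one mixing matrix serves all rows
        (r = 1 → ∀ X b, (σ X).mix b = (σ X).mix 0) ∧
        ∀ (X₀ : PointState n r L) (e : ℕ → Roles n r),
          LinearIndependent K (fun p : (Fin (n - 2 * r) ⊕ Fin r) × Fin (n - 2 * r) =>
            X₀ (e 0 (Sum.inl p.1)) p.2) →
          ∀ t : ℕ,
            (∀ i, LinearIndependent K (stateAfter σ X₀ e (t + 1) i)) ∧
            ∀ S : Finset (Fin n), S.card = k →
              ((k : ℚ) * (2 * (n - 2 * r) - (k - r)) / 2 + r * (k - r) ≤
                Module.finrank K (storedSubspace K (stateAfter σ X₀ e (t + 1)) S)) ∧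
              Function.Injective (fun (f : Fin (packetCount n k r) → L)
                (p : S × Fin (n - 2 * r)) =>
                  linearizedEval (Fintype.card K) f (stateAfter σ X₀ e (t + 1) p.1 p.2))) ∧
      -- the point `(α, γ)`, for a file of `M` bits cut into packets that are elements of `L`
      ∀ M α γ : ℝ, M = packetCount n k r * Real.logb 2 (Fintype.card L) →
        α = 2 * M / (k * (2 * (n - 2 * r) - (k - r)) + 2 * r * (k - r)) * (n - 2 * r) →
        γ = 2 * M / (k * (2 * (n - 2 * r) - (k - r)) + 2 * r * (k - r)) * (r * (n - r)) →
        Achievable n k (n - r) r M α γ ∧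
        (2 * r ≤ k → OnTradeoffCurve n k (n - r) r M α γ) ∧
        (3 * r ≤ k → M / k < α ∧
          2 * M / (k * (2 * (n - r) - k + r)) * (r * (n - r)) < γ) := by
  obtain ⟨κ, rfl⟩ : ∃ κ, k = (κ + 1) * r := by
    obtain ⟨c, rfl⟩ := hrk
    obtain ⟨κ, rfl⟩ := Nat.exists_eq_succ_of_ne_zero (Nat.pos_of_mul_pos_left hk).ne'
    exact ⟨κ, mul_comm _ _⟩
  obtain ⟨ν, hν0, hnν⟩ : ∃ ν, 0 < ν ∧ n = (ν + 2) * r := by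
    obtain ⟨c, rfl⟩ := hrn
    rw [mul_comm] at hn
    obtain ⟨ν, rfl⟩ := Nat.exists_eq_add_of_lt (lt_of_mul_lt_mul_left hn hr.le)
    exact ⟨ν + 1, Nat.succ_pos _, by ring⟩
  have hν : n - 2 * r = ν * r := by rw [hnν, ← Nat.sub_mul, Nat.add_sub_cancel]
  have hd : n - r = (ν + 1) * r := by
    rw [hnν, ← Nat.sub_one_mul]
    rfl
  have hκ : κ ≤ ν := by
    rw [hd] at hkd
    have := Nat.le_of_mul_le_mul_right hkd hr
    omega
  have hcut := two_mul_cutValue hr κ hκ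
  have hpc := packetCount_eq_cutValue hr hκ hnν
  have hcutℝ : 2 * (cutValue ν r ((κ + 1) * r) : ℝ) =
      r ^ 2 * ((κ + 1) * (2 * ν - κ) + 2 * κ) := by exact_mod_cast hcut
  have hcutℚ : 2 * (cutValue ν r ((κ + 1) * r) : ℚ) =
      r ^ 2 * ((κ + 1) * (2 * ν - κ) + 2 * κ) := by exact_mod_cast hcut
  obtain ⟨q₀, hq₀⟩ := exists_round_rule hr hν hν0 hn.le
  refine ⟨q₀, fun K L _ _ _ _ _ hq hL => ?_⟩
  obtain ⟨σ, hσ1, hσ⟩ := hq₀ K L hq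
  refine ⟨⟨σ, hσ1, fun X₀ e hX₀ t => ?_⟩, fun M α γ hM hα hγ => ?_⟩
  · have hspread := isSpread_stateAfter hσ (hX₀.helpersSpread hν) t
    refine ⟨hspread.linearIndependent hν, fun S hS => ?_⟩
    have hfin := hspread S
    rw [hS] at hfin
    refine ⟨?_, ?_⟩
    · refine le_trans (le_of_eq ?_) (Nat.cast_le.2 hfin)
      rw [hnν]
      push_cast
      linear_combination -hcutℚ / 2
    · rw [storedSubspace_eq_span, ← hpc] at hfin
      exact linearizedEval_injective _ hfin
  · set ℓ := Real.logb 2 (Fintype.card L) with hℓ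
    have hℓ0 : 0 < ℓ := Real.logb_pos one_lt_two (by exact_mod_cast Fintype.one_lt_card)
    rw [hpc] at hM
    have hr' : (0 : ℝ) < r := by exact_mod_cast hr
    have hκ' : (κ : ℝ) ≤ ν := by exact_mod_cast hκ
    have hν' : (0 : ℝ) < ν := by exact_mod_cast hν0
    have hκ0 : (0 : ℝ) ≤ κ := Nat.cast_nonneg _
    have hc0 : (0 : ℝ) < cutValue ν r ((κ + 1) * r) := by
      have : (0 : ℝ) < r ^ 2 * ((κ + 1) * (2 * ν - κ) + 2 * κ) := by
        refine mul_pos (by positivity) (add_pos_of_pos_of_nonneg (mul_pos ?_ ?_) ?_) <;> linarith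
      linarith
    have hD : (((κ + 1) * r : ℕ) : ℝ) * (2 * (n - 2 * r) - (((κ + 1) * r : ℕ) - r)) +
        2 * r * ((((κ + 1) * r : ℕ) : ℝ) - r) = 2 * cutValue ν r ((κ + 1) * r) := by
      rw [hnν]
      push_cast
      linear_combination -hcutℝ
    have hα' : α = ((n - 2 * r : ℕ) : ℝ) * ℓ := by
      rw [hα, hD, hM, Nat.cast_sub hn.le]
      push_cast
      field_simp
    have hγ' : γ = ((n - r : ℕ) : ℝ) * (r * ℓ) := by
      rw [hγ, hD, hM, Nat.cast_sub (by omega)]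
      field_simp
    have hach : Achievable n ((κ + 1) * r) (n - r) r M α γ := by
      rw [hM, hα', hγ']
      exact achievable_cutValue hn.le hσ (exists_spread_state hn.le hν hL hσ)
    refine ⟨hach, fun h2 => ⟨hach, fun α' γ' h hle hle' => ?_⟩, fun h3 => ⟨?_, ?_⟩⟩
    · obtain ⟨c, rfl⟩ : ∃ c, κ = c + 1 :=
        Nat.exists_eq_add_of_le' (by have := Nat.le_of_mul_le_mul_right h2 hr; omega)
      rw [hα'] at hle ⊢
      rw [hγ'] at hle' ⊢
      rw [hM] at h
      exact tradeoff_optimal hr hnν rfl hkd hℓ0 h hle hle'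
    · have hκ2 : (2 : ℝ) ≤ κ := by
        have := Nat.le_of_mul_le_mul_right h3 hr
        exact_mod_cast (by omega : 2 ≤ κ)
      rw [hα', hν, hM, div_lt_iff₀ (by exact_mod_cast hk)]
      push_cast
      have h4 : 0 < (r : ℝ) ^ 2 * (κ * (κ - 1)) * ℓ := by
        refine mul_pos (mul_pos (by positivity) (mul_pos ?_ ?_)) hℓ0 <;> linarith
      nlinarith
    · rw [hγ', hM, Nat.cast_sub (by omega : r ≤ n), mul_comm (r : ℝ) (n - r), mul_comm (2 * _ / _),
        mul_assoc]
      have hd0 : (0 : ℝ) < (n : ℝ) - r := by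
        rw [hnν]
        push_cast
        nlinarith
      refine mul_lt_mul_of_pos_left (mul_lt_mul_of_pos_left ?_ hr') hd0
      have h4 : (((κ + 1) * r : ℕ) : ℝ) * (2 * (n - r) - ((κ + 1) * r : ℕ) + r) =
          2 * cutValue ν r ((κ + 1) * r) + 2 * r ^ 2 := by
        rw [hnν]
        push_cast
        linear_combination -hcutℝ
      rw [h4, div_lt_iff₀ (by positivity)]
      have h5 : 0 < (r : ℝ) ^ 2 * ℓ := by positivity
      linarith
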